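/- Fix integers $d,k\ge 0$. **Model.** Let $f:\mathbb R^d\times\mathbb R^k\to\mathbb R^d$ be Borel and, for each $\theta\in\mathbb R^d$, let $\Pi_\theta$ be a Markov kernel on $\mathbb R^k$. Assume: * $\|f(\theta,y)\|\le K(1+\|\theta\|)$ for all $\theta,y$; * every $\Pi_\theta$ has a unique invariant probability measure $\Gamma_\theta$, and $h(\theta)=\int f(\theta,y)\,\Gamma_\theta(dy)$ is Lipschitz with constant $L$; * for every $\theta$ there is a Borel function $v_\theta:\mathbb R^k\to\mathbb R^d$, integrable with respect to every $\Pi_\theta(y;\cdot)$, solving the Poisson equation $v_\theta(y)-\int v_\theta(z)\,\Pi_\theta(y;dz)=f(\theta,y)-h(\theta)$ for all $y$; * for every $R>0$ there is a constant $C_R$ such that $\|v_\theta(y)\|\le C_R(1+\|y\|)$ and $\|v_\theta(y)-v_{\theta'}(y)\|\le C_R\|\theta-\theta'\|(1+\|y\|)$ whenever $\|\theta\|,\|\theta'\|\le R$. **Attractor.** Let $G\subset\mathbb R^d$ be open and let $V:G\to[0,\infty)$ be differentiable with $\langle\nabla V,h\rangle\le 0$ on $G$, such that $H:=\{\theta\in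 G:V(\theta)=0\}=\{\theta\in G:\langle\nabla V(\theta),h(\theta)\rangle=0\}$ is nonempty and compact. Assume that $G$ is contained in the domain of attraction of $H$: every solution of $\dot\theta=h(\theta)$ started in $G$ satisfies $\operatorname{dist}(\theta(t),H)\to0$ as $t\to\infty$. Let $B$ be open with compact closure and $H\subset B\subset\overline B\subset G$. For $A\subset\mathbb R^d$ and $r>0$ write $N_r(A)$ for the open $r$-neighbourhood of $A$, and put $H^r=N_r(H)$. **Recursion.** For step sizes $a(n)$ consider $$\theta_{n+1}=\theta_n+a(n)\,[\,f(\theta_n,Y_n)+M_{n+1}\,],\qquad n\ge0,$$ on a filtered probability space $(\Omega,(\mathcal F_n),P)$, with $\theta_n,Y_n,M_n$ $\mathcal F_n$-measurable, where * $P[Y_{n+1}\in A\mid\mathcal F_n]=\Pi_{\theta_n}(Y_n;A)$ a.s. for every $n$ and every Borel set $A$; * there are a constant $\bar C$ and a deterministic time $n_1$ such that $\|Y_n\|\le\bar C$ a.s. for every $n\ge n_1$; * $M_{n+1}$ is integrable, $E[M_{n+1}\mid\mathcal F_n]=0$, and $\|M_{n+1}\|\le K'(1+\|\theta_n\|)$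 a.s. for every $n$; * $(a(n))$ is positive and non-increasing, with $\sum_n a(n)=\infty$ and $\sum_n a(n)^2<\infty$. Let $t(n)=\sum_{m<n}a(m)$, let $\bar\theta:[0,\infty)\to\mathbb R^d$ be the piecewise linear interpolation with $\bar\theta(t(n))=\theta_n$, and let $s(n)=\sum_{i\ge n}a(i)^2$. **Theorem.** Let $\epsilon_1>0$. There are constants $\hat K,\hat C>0$, depending only on $d,k,f,\Pi,\Gamma,v,K,L,(C_R)_{R>0},G,V,H,B,K',\bar C,\epsilon_1$, with the following property. For all $\epsilon>\epsilon_1$ and $\delta_B>0$ with $N_{\delta_B}(H^{\epsilon_1})\subset H^{\epsilon}\subset B$, all step sizes $(a(n))$ as above and every $n_1$, there is an $N$ such that for every $n_0\ge N$ and every process $(\theta_n,Y_n,M_n)$ as above with $P(\theta_{n_0}\in B)>0$, $$P\big(\bar\theta(t)\to H\,\big|\,\theta_{n_0}\in B\big)\ \ge\ 1-2d\,e^{-\hat K\delta_B^2/(d\,s(n_0))}-2d\,e^{-\hat C\delta_B^2/(d\,s(n_0))},$$ where $\bar\theta(t)\to H$ means $\operatorname{dist}(\bar\theta(t),H)\to0$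 as $t\to\infty$. (For $d=0$ the right-hand side is read as $1$.) -/

import Mathlib

open MeasureTheory ProbabilityTheory Filter Topology
open scoped NNReal ENNReal

/-- `φ` solves the autonomous o.d.e. `φ' = h ∘ φ` on `[0, ∞)` (one-sided derivative at `0`). -/
def IsODESolution {d : ℕ} (h : EuclideanSpace ℝ (Fin d) → EuclideanSpace ℝ (Fin d))
    (φ : ℝ → EuclideanSpace ℝ (Fin d)) : Prop :=
  ∀ t : ℝ, 0 ≤ t → HasDerivWithinAt φ (h (φ t)) (Set.Ici 0) t

/-- The domain of attraction of `H` under the o.d.e. `φ' = h ∘ φ`: the initial points whose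
trajectory converges to `H` (trajectories are unique when `h` is Lipschitz). -/
def domainOfAttraction {d : ℕ} (h : EuclideanSpace ℝ (Fin d) → EuclideanSpace ℝ (Fin d))
    (H : Set (EuclideanSpace ℝ (Fin d))) : Set (EuclideanSpace ℝ (Fin d)) :=
  {x | ∃ φ : ℝ → EuclideanSpace ℝ (Fin d), φ 0 = x ∧ IsODESolution h φ ∧
    Tendsto (fun t => Metric.infDist (φ t) H) atTop (𝓝 0)}

/-- `V` is a strict Lyapunov function on the open set `G`, for the vector field `h`, whose zero set
is the nonempty compact set `H`, and `G` is attracted by `H`. -/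
structure IsLyapunovAttractor {d : ℕ}
    (h : EuclideanSpace ℝ (Fin d) → EuclideanSpace ℝ (Fin d))
    (G : Set (EuclideanSpace ℝ (Fin d))) (V : EuclideanSpace ℝ (Fin d) → ℝ)
    (H : Set (EuclideanSpace ℝ (Fin d))) : Prop where
  isOpen : IsOpen G
  differentiable : DifferentiableOn ℝ V G
  nonneg : ∀ x ∈ G, 0 ≤ V x
  decrease : ∀ x ∈ G, inner ℝ (gradient V x) (h x) ≤ 0
  zero_set : H = {x ∈ G | V x = 0}
  stationary_set : H = {x ∈ G | inner ℝ (gradient V x) (h x) = 0}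
  isCompact : IsCompact H
  nonempty : H.Nonempty
  attracts : G ⊆ domainOfAttraction h H

/-- Non-increasing positive step sizes with `∑ a n = ∞` and `∑ (a n)² < ∞`. -/
structure IsStepSize (a : ℕ → ℝ) : Prop where
  pos : ∀ n, 0 < a n
  antitone : Antitone a
  not_summable : ¬ Summable a
  summable_sq : Summable (fun n => a n ^ 2)

/-- `s(n) = ∑_{i ≥ n} a(i)²`. -/
noncomputable def tailSq (a : ℕ → ℝ) (n : ℕ) : ℝ := ∑' i : ℕ, a (n + i) ^ 2

/-- `t(n) = ∑_{m < n} a(m)`. -/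
noncomputable def clock (a : ℕ → ℝ) (n : ℕ) : ℝ := ∑ m ∈ Finset.range n, a m

/-- The largest `n` with `t(n) ≤ t` (for `t ≥ 0` and step sizes with divergent sum). -/
noncomputable def clockIndex (a : ℕ → ℝ) (t : ℝ) : ℕ := sSup {n : ℕ | clock a n ≤ t}

/-- The piecewise linear interpolation of `x` at the times `t(n)`: the value at `t(n)` is `x n`, and
the path is affine on each `[t(n), t(n+1)]`. -/
noncomputable def interpolate {d : ℕ} (a : ℕ → ℝ) (x : ℕ → EuclideanSpace ℝ (Fin d)) (t : ℝ) :
    EuclideanSpace ℝ (Fin d) :=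
  x (clockIndex a t) + ((t - clock a (clockIndex a t)) / a (clockIndex a t)) •
    (x (clockIndex a t + 1) - x (clockIndex a t))

/-- The averaged vector field `h(θ) = ∫ f(θ, y) Γ_θ(dy)`. -/
noncomputable def meanField {d k : ℕ}
    (f : EuclideanSpace ℝ (Fin d) → EuclideanSpace ℝ (Fin k) → EuclideanSpace ℝ (Fin d))
    (Γ : EuclideanSpace ℝ (Fin d) → Measure (EuclideanSpace ℝ (Fin k)))
    (θ : EuclideanSpace ℝ (Fin d)) : EuclideanSpace ℝ (Fin d) :=
  ∫ y, f θ y ∂(Γ θ)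

/-- The assumptions on the vector field `f` and on the transition kernels `Π_θ` (here `Q θ`). -/
structure IsAveragingModel {d k : ℕ}
    (f : EuclideanSpace ℝ (Fin d) → EuclideanSpace ℝ (Fin k) → EuclideanSpace ℝ (Fin d))
    (Q : EuclideanSpace ℝ (Fin d) →
      Kernel (EuclideanSpace ℝ (Fin k)) (EuclideanSpace ℝ (Fin k)))
    (Γ : EuclideanSpace ℝ (Fin d) → Measure (EuclideanSpace ℝ (Fin k)))
    (v : EuclideanSpace ℝ (Fin d) → EuclideanSpace ℝ (Fin k) → EuclideanSpace ℝ (Fin d))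
    (K : ℝ) (L : ℝ≥0) (C : ℝ → ℝ) : Prop where
  measurable_f : Measurable (Function.uncurry f)
  markov : ∀ θ, IsMarkovKernel (Q θ)
  /-- Linear growth of `f`, uniformly in the noise variable. -/
  growth : ∀ θ y, ‖f θ y‖ ≤ K * (1 + ‖θ‖)
  /-- `Γ θ` is the unique invariant probability measure of `Q θ`. -/
  prob : ∀ θ, IsProbabilityMeasure (Γ θ)
  invariant : ∀ θ, Kernel.Invariant (Q θ) (Γ θ)
  unique : ∀ θ (μ : Measure (EuclideanSpace ℝ (Fin k))), IsProbabilityMeasure μ →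
    Kernel.Invariant (Q θ) μ → μ = Γ θ
  lipschitz : LipschitzWith L (meanField f Γ)
  /-- `v θ` solves the Poisson equation `(1 - Π_θ) v_θ = f(θ, ·) - h(θ)`. -/
  measurable_v : ∀ θ, Measurable (v θ)
  integrable_v : ∀ θ y, Integrable (v θ) (Q θ y)
  poisson : ∀ θ y, v θ y - ∫ z, v θ z ∂(Q θ y) = f θ y - meanField f Γ θ
  /-- Local bounds on the solutions of the Poisson equation. -/
  bound_v : ∀ R : ℝ, 0 < R → ∀ θ y, ‖θ‖ ≤ R → ‖v θ y‖ ≤ C R * (1 + ‖y‖)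
  lipschitz_v : ∀ R : ℝ, 0 < R → ∀ θ θ' y, ‖θ‖ ≤ R → ‖θ'‖ ≤ R →
    ‖v θ y - v θ' y‖ ≤ C R * ‖θ - θ'‖ * (1 + ‖y‖)

/-- The stochastic approximation `θ_{n+1} = θ_n + a(n) [f(θ_n, Y_n) + M_{n+1}]` on a filtered
probability space, with Markov iterate-dependent noise `Y` and martingale difference noise `M`. -/
structure IsStochasticApproximation {d k : ℕ}
    (f : EuclideanSpace ℝ (Fin d) → EuclideanSpace ℝ (Fin k) → EuclideanSpace ℝ (Fin d))
    (Q : EuclideanSpace ℝ (Fin d) →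
      Kernel (EuclideanSpace ℝ (Fin k)) (EuclideanSpace ℝ (Fin k)))
    (a : ℕ → ℝ) (K' Cbar : ℝ) (n₁ : ℕ)
    {Ω : Type*} {mΩ : MeasurableSpace Ω} (P : Measure Ω) (ℱ : Filtration ℕ mΩ)
    (θ : ℕ → Ω → EuclideanSpace ℝ (Fin d)) (Y : ℕ → Ω → EuclideanSpace ℝ (Fin k))
    (M : ℕ → Ω → EuclideanSpace ℝ (Fin d)) : Prop where
  measurable_θ : ∀ n, Measurable[ℱ n] (θ n)
  measurable_Y : ∀ n, Measurable[ℱ n] (Y n)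
  measurable_M : ∀ n, Measurable[ℱ (n + 1)] (M (n + 1))
  recursion : ∀ n ω, θ (n + 1) ω = θ n ω + a n • (f (θ n ω) (Y n ω) + M (n + 1) ω)
  /-- `P[Y_{n+1} ∈ A | ℱ_n] = Π_{θ_n}(Y_n; A)` almost surely. -/
  markov : ∀ n (A : Set (EuclideanSpace ℝ (Fin k))), MeasurableSet A →
    P[(Y (n + 1) ⁻¹' A).indicator (fun _ => (1 : ℝ)) | ℱ n]
      =ᵐ[P] fun ω => (Q (θ n ω) (Y n ω)).real A
  /-- From the deterministic time `n₁` on, the Markov noise is bounded by `Cbar`. -/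
  bounded_Y : ∀ n, n₁ ≤ n → ∀ᵐ ω ∂P, ‖Y n ω‖ ≤ Cbar
  /-- `M` is a martingale difference sequence of linear growth. -/
  integrable_M : ∀ n, Integrable (M (n + 1)) P
  condExp_M : ∀ n, P[M (n + 1) | ℱ n] =ᵐ[P] 0
  growth_M : ∀ n, ∀ᵐ ω ∂P, ‖M (n + 1) ω‖ ≤ K' * (1 + ‖θ n ω‖)

/-! The recursion is an Euler scheme for `θ' = h(θ)` with a perturbation, and the Poisson equation
splits that perturbation. Replacing `v_θ(Y_n)` by `v_θ(Y_{n+1})` at `θ = θ_n` turns `f(θ_n, Y_n) -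
h(θ_n)` into a martingale difference plus `v_θ(Y_n) - v_θ(Y_{n+1})`. Weighted by the steps, the
latter sums by parts to `O(a(m) + s(m))` as long as the iterates stay in a ball
(`norm_sum_v_sub_le`). This part is deterministic and disappears for large `n₀`; only the martingale
part costs probability.

Deterministic side: Lyapunov stability and compactness give one time `T` after which all
trajectories from `B` are in `H^{ε₁}` (`exists_uniform_attraction`). If the accumulated errors over
every window are small against `δ exp(-L(T+1))`, a discrete Grönwall estimate
(`norm_sub_trajectory_le`) keeps the scheme within `δ` of the trajectory, so it is back in `B` after
time about `T`, and the argument restarts there (`exists_mem_of_perturbed_euler`). If the noise sums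
also converge, tracking over longer windows forces convergence to `H`
(`tendsto_infDist_of_perturbed_euler`).

Probabilistic side: truncating the noise outside a ball makes its increments `O(a(n))`, also under
the law conditioned on `θ_{n₀} ∈ B`. A maximal Azuma-Hoeffding inequality over the infinite horizon
(`measure_exists_le_norm`) bounds the probability that the noise sums started at `n₀` ever reach
`η`, a multiple of `δ`. A sum over any window is a difference of two such sums, so one event
controls all windows at once. On its complement the path never leaves the ball, so the truncation
never acts. -/

/-! ### Stability and uniform attraction for the limiting differential equation -/

namespace IsODESolution

variable {d : ℕ} {h : EuclideanSpace ℝ (Fin d) → EuclideanSpace ℝ (Fin d)}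
  {φ ψ : ℝ → EuclideanSpace ℝ (Fin d)}

theorem continuousOn (hφ : IsODESolution h φ) : ContinuousOn φ (Set.Ici 0) :=
  fun t ht => (hφ t ht).continuousWithinAt

theorem hasDerivWithinAt_Ici (hφ : IsODESolution h φ) {t : ℝ} (ht : 0 ≤ t) :
    HasDerivWithinAt φ (h (φ t)) (Set.Ici t) t :=
  (hφ t ht).mono (Set.Ici_subset_Ici.2 ht)

theorem shift (hφ : IsODESolution h φ) {s : ℝ} (hs : 0 ≤ s) :
    IsODESolution h (fun t => φ (s + t)) := by
  intro t ht
  have h1 := hφ (s + t) (add_nonneg hs ht)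
  have h2 : HasDerivWithinAt (fun t : ℝ => s + t) 1 (Set.Ici 0) t :=
    ((hasDerivAt_id t).const_add s).hasDerivWithinAt
  have h3 : Set.MapsTo (fun t : ℝ => s + t) (Set.Ici 0) (Set.Ici 0) :=
    fun x hx => add_nonneg hs hx
  have h4 := HasDerivWithinAt.scomp t h1 h2 h3
  rw [one_smul] at h4
  exact h4

/-- Grönwall's inequality; for equal initial points it is uniqueness of trajectories. -/
theorem dist_le {L : ℝ≥0} (hL : LipschitzWith L h) (hφ : IsODESolution h φ)
    (hψ : IsODESolution h ψ) {t : ℝ} (ht : 0 ≤ t) :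
    dist (φ t) (ψ t) ≤ dist (φ 0) (ψ 0) * Real.exp (L * t) := by
  have := dist_le_of_trajectories_ODE (v := fun _ => h) (a := 0) (b := t) (fun _ => hL)
    (hφ.continuousOn.mono Set.Icc_subset_Ici_self)
    (fun s hs => hφ.hasDerivWithinAt_Ici hs.1)
    (hψ.continuousOn.mono Set.Icc_subset_Ici_self)
    (fun s hs => hψ.hasDerivWithinAt_Ici hs.1) le_rfl t ⟨ht, le_rfl⟩
  simpa using this

end IsODESolution

namespace IsLyapunovAttractor

variable {d : ℕ} {h : EuclideanSpace ℝ (Fin d) → EuclideanSpace ℝ (Fin d)}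
  {G : Set (EuclideanSpace ℝ (Fin d))} {V : EuclideanSpace ℝ (Fin d) → ℝ}
  {H : Set (EuclideanSpace ℝ (Fin d))}

theorem subset (hH : IsLyapunovAttractor h G V H) : H ⊆ G := by
  intro x hx
  rw [hH.zero_set] at hx
  exact hx.1

/-- The Lyapunov function does not increase along a trajectory that stays in `G`. -/
theorem apply_le_apply_zero (hH : IsLyapunovAttractor h G V H)
    {φ : ℝ → EuclideanSpace ℝ (Fin d)} (hφ : IsODESolution h φ) {t : ℝ} (ht : 0 ≤ t)
    (hG : ∀ s ∈ Set.Icc 0 t, φ s ∈ G) : V (φ t) ≤ V (φ 0) := by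
  have hanti : AntitoneOn (fun s => V (φ s)) (Set.Icc 0 t) := by
    refine antitoneOn_of_hasDerivWithinAt_nonpos
      (f' := fun s => inner ℝ (gradient V (φ s)) (h (φ s))) (convex_Icc 0 t) ?_ ?_ ?_
    · exact hH.differentiable.continuousOn.comp
        (hφ.continuousOn.mono Set.Icc_subset_Ici_self) hG
    · intro s hs
      rw [interior_Icc] at hs ⊢
      have hsG := hG s ⟨hs.1.le, hs.2.le⟩
      have h1 : HasGradientAt V (gradient V (φ s)) (φ s) :=
        ((hH.differentiable _ hsG).differentiableAt (hH.isOpen.mem_nhds hsG)).hasGradientAt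
      have h2 := (hφ s hs.1.le).mono
        (show Set.Ioo 0 t ⊆ Set.Ici 0 from fun x hx => hx.1.le)
      have h3 := h1.hasFDerivAt.comp_hasDerivWithinAt s h2
      have h4 : HasDerivWithinAt (fun s => V (φ s)) _ (Set.Ioo 0 t) s := h3
      simpa using h4
    · intro s hs
      rw [interior_Icc] at hs
      exact hH.decrease _ (hG s ⟨hs.1.le, hs.2.le⟩)
  exact hanti ⟨le_rfl, ht⟩ ⟨ht, le_rfl⟩ ht

/-- `H` is Lyapunov stable. -/
theorem exists_isOpen_forall_mem_thickening (hH : IsLyapunovAttractor h G V H) {ε : ℝ}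
    (hε : 0 < ε) :
    ∃ U, IsOpen U ∧ H ⊆ U ∧ ∀ φ, IsODESolution h φ → φ 0 ∈ U →
      ∀ t, 0 ≤ t → φ t ∈ Metric.thickening ε H := by
  obtain ⟨r, hr, hrG⟩ := hH.isCompact.exists_cthickening_subset_open hH.isOpen hH.subset
  have hne := hH.nonempty
  obtain ⟨ρ, hρ, hρr, hρε⟩ : ∃ ρ, 0 < ρ ∧ ρ ≤ r ∧ ρ ≤ ε :=
    ⟨min r ε, lt_min hr hε, min_le_left _ _, min_le_right _ _⟩
  have hmemc : ∀ x, Metric.infDist x H ≤ ρ → x ∈ Metric.cthickening ρ H := fun x hx =>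
    Metric.mem_cthickening_iff.2
      ((ENNReal.le_ofReal_iff_toReal_le (Metric.infEDist_ne_top hne) hρ.le).2 hx)
  have hmemG : ∀ x, Metric.infDist x H ≤ ρ → x ∈ G := fun x hx =>
    hrG (Metric.cthickening_mono hρr _ (hmemc x hx))
  have hcont : Continuous fun x => Metric.infDist x H := Metric.continuous_infDist_pt H
  have hSc : IsCompact {x | Metric.infDist x H = ρ} := by
    refine hH.isCompact.cthickening (r := ρ) |>.of_isClosed_subset
      (isClosed_eq hcont continuous_const) fun x hx => ?_
    exact hmemc x (le_of_eq hx)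
  -- `V` is positive on the compact level set at distance `ρ` from `H`, hence at least some `c > 0`
  -- there. A trajectory starting with `V < c` inside the level set cannot cross it.
  obtain ⟨c, hc, hcV⟩ := hSc.exists_forall_le' (f := V) (a := 0)
    (hH.differentiable.continuousOn.mono fun x hx => hmemG x (le_of_eq hx)) (by
      intro x hx
      have hxG := hmemG x (le_of_eq hx)
      refine lt_of_le_of_ne (hH.nonneg x hxG) fun h0 => ?_
      have : x ∈ H := by
        rw [hH.zero_set]
        exact ⟨hxG, h0.symm⟩
      have h0 := Metric.infDist_zero_of_mem this
      rw [Set.mem_ofPred_eq, h0] at hx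
      exact hρ.ne hx)
  refine ⟨{x | Metric.infDist x H < ρ} ∩ (G ∩ V ⁻¹' Set.Iio c),
    (isOpen_lt hcont continuous_const).inter
      (hH.differentiable.continuousOn.isOpen_inter_preimage hH.isOpen isOpen_Iio), ?_, ?_⟩
  · intro x hx
    refine ⟨by simpa [Metric.infDist_zero_of_mem hx] using hρ, hH.subset hx, ?_⟩
    rw [hH.zero_set] at hx
    simpa [hx.2] using hc
  · intro φ hφ h0 t ht
    have hg : ContinuousOn (fun s => Metric.infDist (φ s) H) (Set.Ici 0) :=
      hcont.comp_continuousOn hφ.continuousOn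
    have key : Metric.infDist (φ t) H < ρ := by
      by_contra! hcon
      have hS : IsCompact {s | s ∈ Set.Icc 0 t ∧ Metric.infDist (φ s) H = ρ} := by
        have := (hg.mono fun s (hs : s ∈ Set.Icc 0 t) => hs.1).preimage_isClosed_of_isClosed
          isClosed_Icc (isClosed_singleton (x := ρ))
        exact isCompact_Icc.of_isClosed_subset this fun s hs => hs.1
      have hSne : {s | s ∈ Set.Icc 0 t ∧ Metric.infDist (φ s) H = ρ}.Nonempty := by
        obtain ⟨s, hs, hs'⟩ := intermediate_value_Icc ht
          (hg.mono fun s hs => hs.1) ⟨h0.1.le, hcon⟩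
        exact ⟨s, hs, hs'⟩
      -- The first hitting time of the level set: up to it the path is in `G`, so `V` has not
      -- increased.
      obtain ⟨s, ⟨hs, hsρ⟩, hmin⟩ := hS.exists_isLeast hSne
      have hbefore : ∀ u ∈ Set.Icc 0 s, Metric.infDist (φ u) H ≤ ρ := by
        intro u hu
        by_contra hcu
        push Not at hcu
        obtain ⟨w, hw, hw'⟩ := intermediate_value_Icc hu.1
          (hg.mono fun s hs => hs.1) ⟨h0.1.le, hcu.le⟩
        have hsw := hmin ⟨⟨hw.1, hw.2.trans (hu.2.trans hs.2)⟩, hw'⟩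
        have : u = s := le_antisymm hu.2 (hsw.trans hw.2)
        rw [this, hsρ] at hcu
        exact lt_irrefl _ hcu
      have hV := hH.apply_le_apply_zero hφ hs.1 fun u hu => hmemG _ (hbefore u hu)
      have h1 := hcV _ hsρ
      have h2 : V (φ 0) < c := h0.2.2
      linarith
    exact (Metric.mem_thickening_iff_infDist_lt hne).2 (key.trans_le hρε)

/-- Trajectories from a compact subset of `G` are uniformly bounded and uniformly attracted. -/
theorem exists_uniform_attraction (hH : IsLyapunovAttractor h G V H) {L : ℝ≥0}
    (hL : LipschitzWith L h) {S : Set (EuclideanSpace ℝ (Fin d))} (hS : IsCompact S)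
    (hSG : S ⊆ G) {ε : ℝ} (hε : 0 < ε) :
    ∃ T R : ℝ, ∀ φ, IsODESolution h φ → φ 0 ∈ S →
      (∀ t, 0 ≤ t → ‖φ t‖ ≤ R) ∧ ∀ t, 0 ≤ t → T ≤ t → φ t ∈ Metric.thickening ε H := by
  obtain ⟨U, hU, hHU, hstab⟩ := hH.exists_isOpen_forall_mem_thickening hε
  obtain ⟨R₁, hR₁⟩ : ∃ R₁, ∀ x ∈ Metric.thickening ε H, ‖x‖ ≤ R₁ :=
    hH.isCompact.isBounded.thickening.exists_norm_le
  -- The bounds `T`, `R` pass to subsets and finite unions, so it suffices to find them near each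
  -- point. There, the trajectory of the point enters the stable neighbourhood `U` at some time `τ`,
  -- and nearby ones follow by Grönwall.
  refine hS.induction_on
    (p := fun A => ∃ T R : ℝ, ∀ φ, IsODESolution h φ → φ 0 ∈ A →
      (∀ t, 0 ≤ t → ‖φ t‖ ≤ R) ∧ ∀ t, 0 ≤ t → T ≤ t → φ t ∈ Metric.thickening ε H)
    ⟨0, 0, fun φ _ h0 => h0.elim⟩ ?_ ?_ ?_
  · rintro A A' hAA' ⟨T, R, hTR⟩
    exact ⟨T, R, fun φ hφ h0 => hTR φ hφ (hAA' h0)⟩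
  · rintro A A' ⟨T, R, hTR⟩ ⟨T', R', hTR'⟩
    refine ⟨max T T', max R R', fun φ hφ h0 => ?_⟩
    rcases h0 with h0 | h0
    · exact ⟨fun t ht => ((hTR φ hφ h0).1 t ht).trans (le_max_left _ _),
        fun t ht hT => (hTR φ hφ h0).2 t ht ((le_max_left _ _).trans hT)⟩
    · exact ⟨fun t ht => ((hTR' φ hφ h0).1 t ht).trans (le_max_right _ _),
        fun t ht hT => (hTR' φ hφ h0).2 t ht ((le_max_right _ _).trans hT)⟩
  · intro x hx
    obtain ⟨φ, hφ0, hφ, hlim⟩ := hH.attracts (hSG hx)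
    obtain ⟨r, hr, hrU⟩ := hH.isCompact.exists_thickening_subset_open hU hHU
    obtain ⟨τ, hτ0, hτ⟩ : ∃ τ, 0 ≤ τ ∧ φ τ ∈ U := by
      obtain ⟨τ, hτ, hτ0⟩ := ((hlim.eventually (gt_mem_nhds hr)).and (eventually_ge_atTop 0)).exists
      exact ⟨τ, hτ0, hrU ((Metric.mem_thickening_iff_infDist_lt hH.nonempty).2 hτ)⟩
    obtain ⟨ρ, hρ, hρU⟩ := Metric.isOpen_iff.1 hU _ hτ
    obtain ⟨R₂, hR₂⟩ : ∃ R₂, ∀ y ∈ φ '' Set.Icc 0 τ, ‖y‖ ≤ R₂ :=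
      (isCompact_Icc.image_of_continuousOn
        (hφ.continuousOn.mono Set.Icc_subset_Ici_self)).isBounded.exists_norm_le
    have hexp : 0 < Real.exp (L * τ) := Real.exp_pos _
    refine ⟨Metric.ball x (ρ / Real.exp (L * τ)),
      mem_nhdsWithin_of_mem_nhds (Metric.ball_mem_nhds x (div_pos hρ hexp)),
      τ, max R₁ (R₂ + ρ), fun ψ hψ h0 => ?_⟩
    have hclose : ∀ t ∈ Set.Icc 0 τ, dist (ψ t) (φ t) < ρ := by
      intro t ht
      have h1 := hψ.dist_le hL hφ ht.1
      rw [hφ0] at h1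
      have h2 : dist (ψ 0) x < ρ / Real.exp (L * τ) := h0
      have h3 : Real.exp (L * t) ≤ Real.exp (L * τ) := by
        apply Real.exp_le_exp.2
        gcongr
        exact ht.2
      calc dist (ψ t) (φ t) ≤ dist (ψ 0) x * Real.exp (L * t) := h1
        _ ≤ dist (ψ 0) x * Real.exp (L * τ) := by gcongr
        _ < ρ / Real.exp (L * τ) * Real.exp (L * τ) := by gcongr
        _ = ρ := by field_simp
    have hafter : ∀ t, τ ≤ t → ψ t ∈ Metric.thickening ε H := by
      intro t ht
      have := hstab _ (hψ.shift hτ0) (by simpa using hρU (hclose τ ⟨hτ0, le_rfl⟩)) (t - τ)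
        (sub_nonneg.2 ht)
      simpa using this
    refine ⟨fun t ht => ?_, fun t _ ht => hafter t ht⟩
    rcases le_total t τ with htτ | htτ
    · refine le_trans ?_ (le_max_right _ _)
      have h1 := hclose t ⟨ht, htτ⟩
      have h2 := hR₂ (φ t) ⟨t, ⟨ht, htτ⟩, rfl⟩
      rw [dist_eq_norm] at h1
      have h3 : ‖ψ t‖ ≤ ‖φ t‖ + ‖ψ t - φ t‖ := by
        simpa using norm_add_le (φ t) (ψ t - φ t)
      linarith
    · exact (hR₁ _ (hafter t htτ)).trans (le_max_left _ _)

end IsLyapunovAttractor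

/-! ### The clock and the interpolated path -/

theorem clock_succ (a : ℕ → ℝ) (n : ℕ) : clock a (n + 1) = clock a n + a n :=
  Finset.sum_range_succ _ _

theorem tendsto_tailSq (a : ℕ → ℝ) : Tendsto (tailSq a) atTop (𝓝 0) := by
  -- No summability is required: the tails of a divergent series are all `0` by the convention for
  -- `tsum`.
  have := tendsto_sum_nat_add fun n => a n ^ 2
  refine this.congr fun n => ?_
  simp only [tailSq, add_comm]

namespace IsStepSize

variable {a : ℕ → ℝ}

theorem clock_strictMono (ha : IsStepSize a) : StrictMono (clock a) :=
  strictMono_nat_of_lt_succ fun n => by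
    rw [clock_succ]
    linarith [ha.pos n]

theorem tendsto_clock (ha : IsStepSize a) : Tendsto (clock a) atTop atTop :=
  (not_summable_iff_tendsto_nat_atTop_of_nonneg fun n => (ha.pos n).le).1 ha.not_summable

theorem tendsto_zero (ha : IsStepSize a) : Tendsto a atTop (𝓝 0) := by
  have h1 := ha.summable_sq.tendsto_atTop_zero
  have h2 := h1.sqrt
  rw [Real.sqrt_zero] at h2
  exact h2.congr fun n => Real.sqrt_sq (ha.pos n).le

theorem summable_tail (ha : IsStepSize a) (n : ℕ) : Summable fun i => a (n + i) ^ 2 := by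
  simpa only [add_comm] using (summable_nat_add_iff n).2 ha.summable_sq

theorem tailSq_pos (ha : IsStepSize a) (n : ℕ) : 0 < tailSq a n :=
  (ha.summable_tail n).tsum_pos (fun _ => sq_nonneg _) 0 (pow_pos (ha.pos _) 2)

theorem sum_range_le_tailSq (ha : IsStepSize a) (n k : ℕ) :
    ∑ i ∈ Finset.range k, a (n + i) ^ 2 ≤ tailSq a n :=
  (ha.summable_tail n).sum_le_tsum _ fun _ _ => sq_nonneg _

theorem sum_Ico_le_tailSq (ha : IsStepSize a) {n m j : ℕ} (hnm : n ≤ m) :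
    ∑ i ∈ Finset.Ico m j, a i ^ 2 ≤ tailSq a n := by
  refine le_trans ?_ (ha.sum_range_le_tailSq n (j - n))
  rw [← Finset.sum_Ico_eq_sum_range (fun i => a i ^ 2)]
  exact Finset.sum_le_sum_of_subset_of_nonneg (Finset.Ico_subset_Ico_left hnm)
    fun _ _ _ => sq_nonneg _

theorem bddAbove_clock_le (ha : IsStepSize a) (t : ℝ) : BddAbove {n : ℕ | clock a n ≤ t} := by
  obtain ⟨N, hN⟩ := (ha.tendsto_clock.eventually_gt_atTop t).exists
  refine ⟨N, fun n hn => ?_⟩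
  by_contra! hlt
  exact absurd (hn.trans_lt hN) (not_lt.2 (ha.clock_strictMono hlt).le)

theorem clock_clockIndex_le (ha : IsStepSize a) {t : ℝ} (ht : 0 ≤ t) :
    clock a (clockIndex a t) ≤ t :=
  Nat.sSup_mem (s := {n : ℕ | clock a n ≤ t}) ⟨0, by simpa [clock] using ht⟩
    (ha.bddAbove_clock_le t)

theorem lt_clock_clockIndex_succ (ha : IsStepSize a) (t : ℝ) :
    t < clock a (clockIndex a t + 1) := by
  by_contra! hle
  have := le_csSup (ha.bddAbove_clock_le t) hle
  exact absurd this (Nat.not_succ_le_self _)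

theorem tendsto_clockIndex (ha : IsStepSize a) : Tendsto (clockIndex a) atTop atTop := by
  refine tendsto_atTop.2 fun n => ?_
  filter_upwards [eventually_ge_atTop (clock a n)] with t ht
  exact le_csSup (ha.bddAbove_clock_le t) ht

/-- The interpolated point lies within one increment of the last iterate, and the increments vanish.
-/
theorem tendsto_infDist_interpolate (ha : IsStepSize a) {d : ℕ}
    {x : ℕ → EuclideanSpace ℝ (Fin d)} {H : Set (EuclideanSpace ℝ (Fin d))}
    (hx : Tendsto (fun n => Metric.infDist (x n) H) atTop (𝓝 0))
    (hdiff : Tendsto (fun n => ‖x (n + 1) - x n‖) atTop (𝓝 0)) :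
    Tendsto (fun t => Metric.infDist (interpolate a x t) H) atTop (𝓝 0) := by
  have hlim := (hx.add hdiff).comp ha.tendsto_clockIndex
  rw [add_zero] at hlim
  refine squeeze_zero' (Eventually.of_forall fun t => Metric.infDist_nonneg) ?_ hlim
  filter_upwards [eventually_ge_atTop 0] with t ht
  set n := clockIndex a t with hn
  have h1 := ha.clock_clockIndex_le ht
  have h2 := ha.lt_clock_clockIndex_succ t
  rw [← hn, clock_succ] at h2
  rw [← hn] at h1
  have hpos := ha.pos n
  refine (Metric.infDist_le_infDist_add_dist (y := x n)).trans ?_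
  simp only [Function.comp, ← hn]
  gcongr
  rw [dist_eq_norm]
  simp only [interpolate, ← hn, add_sub_cancel_left, norm_smul, Real.norm_eq_abs]
  refine mul_le_of_le_one_left (norm_nonneg _) ?_
  rw [abs_of_nonneg (div_nonneg (by linarith) hpos.le), div_le_one hpos]
  linarith

end IsStepSize

/-! ### Perturbed Euler schemes -/

section PerturbedEuler

variable {d : ℕ} {h : EuclideanSpace ℝ (Fin d) → EuclideanSpace ℝ (Fin d)} {L : ℝ≥0}

theorem IsODESolution.norm_sub_le {φ : ℝ → EuclideanSpace ℝ (Fin d)} (hφ : IsODESolution h φ)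
    {b : ℝ} (hb : ∀ t, 0 ≤ t → ‖h (φ t)‖ ≤ b) {s t : ℝ} (hs : 0 ≤ s) (hst : s ≤ t) :
    ‖φ t - φ s‖ ≤ b * (t - s) :=
  norm_image_sub_le_of_norm_deriv_right_le_segment
    (hφ.continuousOn.mono fun _ hu => hs.trans hu.1)
    (fun _ hu => hφ.hasDerivWithinAt_Ici (hs.trans hu.1))
    (fun u hu => hb u (hs.trans hu.1)) t ⟨hst, le_rfl⟩

/-- The map `u ↦ φ u - u • h (φ s)` has derivative `h (φ u) - h (φ s)`, of norm at most `L * b * r`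
on the step. -/
theorem IsODESolution.norm_euler_step_le {φ : ℝ → EuclideanSpace ℝ (Fin d)}
    (hL : LipschitzWith L h) (hφ : IsODESolution h φ)
    {b : ℝ} (hb : ∀ t, 0 ≤ t → ‖h (φ t)‖ ≤ b) {s r : ℝ} (hs : 0 ≤ s) (hr : 0 ≤ r) :
    ‖φ (s + r) - φ s - r • h (φ s)‖ ≤ L * b * r ^ 2 := by
  have hb0 : 0 ≤ b := (norm_nonneg _).trans (hb 0 le_rfl)
  have key := norm_image_sub_le_of_norm_deriv_right_le_segment
    (f := fun u => φ u - u • h (φ s)) (f' := fun u => h (φ u) - h (φ s)) (a := s) (b := s + r)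
    (C := L * (b * r))
    ((hφ.continuousOn.mono fun _ hu => hs.trans hu.1).sub (by fun_prop))
    (fun u hu => by
      have h1 := hφ.hasDerivWithinAt_Ici (hs.trans hu.1)
      have h2 := ((hasDerivAt_id u).smul_const (h (φ s))).hasDerivWithinAt (s := Set.Ici u)
      rw [one_smul] at h2
      exact h1.sub h2)
    (fun u hu => by
      refine (hL.norm_sub_le _ _).trans ?_
      gcongr
      refine (hφ.norm_sub_le hb hs hu.1).trans ?_
      gcongr
      linarith [hu.2]) (s + r) ⟨by linarith, le_rfl⟩
  have e1 : φ (s + r) - (s + r) • h (φ s) - (φ s - s • h (φ s))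
      = φ (s + r) - φ s - r • h (φ s) := by
    rw [add_smul]
    abel
  rw [e1] at key
  refine key.trans (le_of_eq ?_)
  ring

/-- A perturbed Euler scheme stays close to the trajectory with the same initial point. -/
theorem norm_sub_trajectory_le (hL : LipschitzWith L h) {a : ℕ → ℝ} (ha : ∀ n, 0 ≤ a n)
    {x e : ℕ → EuclideanSpace ℝ (Fin d)} (hx : ∀ n, x (n + 1) = x n + a n • h (x n) + e n)
    {φ : ℝ → EuclideanSpace ℝ (Fin d)} (hφ : IsODESolution h φ) {b : ℝ}
    (hb : ∀ t, 0 ≤ t → ‖h (φ t)‖ ≤ b) {m n : ℕ} (hmn : m ≤ n) (h0 : φ 0 = x m) {η : ℝ}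
    (hη : ∀ j, m ≤ j → j ≤ n → ‖∑ i ∈ Finset.Ico m j, e i‖ ≤ η) :
    ‖x n - φ (clock a n - clock a m)‖ ≤
      Real.exp (L * (clock a n - clock a m)) *
        (η + L * b * ∑ i ∈ Finset.Ico m n, a i ^ 2) := by
  have hb0 : 0 ≤ b := (norm_nonneg _).trans (hb 0 le_rfl)
  have hclock : ∀ j, m ≤ j → clock a m ≤ clock a j := fun j hj =>
    monotone_nat_of_le_succ (fun n => by rw [clock_succ]; linarith [ha n]) hj
  have hη0 : 0 ≤ η := by simpa using hη m le_rfl hmn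
  -- Subtracting the error sum first means that only partial sums, not single errors, have to be
  -- small. Adding `η` to the norm makes the recursion linear: `u ↦ (1 + L a_j) u + L b a_j²`.
  have key : ∀ j, m ≤ j → j ≤ n →
      ‖x j - φ (clock a j - clock a m) - ∑ i ∈ Finset.Ico m j, e i‖ + η ≤
      Real.exp (L * (clock a j - clock a m)) *
        (η + L * b * ∑ i ∈ Finset.Ico m j, a i ^ 2) := by
    intro j hj
    induction j, hj using Nat.le_induction with
    | base => simp [h0]
    | succ j hj ih =>
      intro hjn
      have ih := ih (by omega)
      have hEj := hη j hj (by omega)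
      set τ := clock a j - clock a m with hτ
      have hτ0 : 0 ≤ τ := sub_nonneg.2 (hclock j hj)
      have hτ1 : clock a (j + 1) - clock a m = τ + a j := by rw [clock_succ, hτ]; ring
      rw [hτ1, Finset.sum_Ico_succ_top hj, Finset.sum_Ico_succ_top hj]
      set E := ∑ i ∈ Finset.Ico m j, e i
      set σ := ∑ i ∈ Finset.Ico m j, a i ^ 2
      have hσ : 0 ≤ σ := Finset.sum_nonneg fun _ _ => sq_nonneg _
      set Z := x j - φ τ - E with hZ
      have hstep := hφ.norm_euler_step_le hL hb hτ0 (ha j)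
      have hxφ : ‖x j - φ τ‖ ≤ ‖Z‖ + η := by
        have : x j - φ τ = Z + E := by rw [hZ]; abel
        rw [this]
        exact (norm_add_le _ _).trans (by gcongr)
      have hdec : x (j + 1) - φ (τ + a j) - (E + e j) =
          Z + a j • (h (x j) - h (φ τ)) - (φ (τ + a j) - φ τ - a j • h (φ τ)) := by
        rw [hx, hZ, smul_sub]
        abel
      have h1 : ‖a j • (h (x j) - h (φ τ))‖ ≤ a j * (L * (‖Z‖ + η)) := by
        rw [norm_smul, Real.norm_of_nonneg (ha j)]
        have := hL.norm_sub_le (x j) (φ τ)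
        have haj := ha j
        gcongr
        exact this.trans (by gcongr)
      have h2 : ‖x (j + 1) - φ (τ + a j) - (E + e j)‖ ≤
          ‖Z‖ + a j * (L * (‖Z‖ + η)) + L * b * a j ^ 2 := by
        rw [hdec]
        exact (norm_sub_le _ _).trans (add_le_add ((norm_add_le _ _).trans (by gcongr)) hstep)
      have h3 : 1 + L * a j ≤ Real.exp (L * a j) := by
        linarith [Real.add_one_le_exp (L * a j)]
      have hexp1 : 1 ≤ Real.exp (L * (τ + a j)) :=
        Real.one_le_exp (mul_nonneg L.2 (add_nonneg hτ0 (ha j)))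
      have hexp : Real.exp (L * (τ + a j)) = Real.exp (L * a j) * Real.exp (L * τ) := by
        rw [← Real.exp_add]
        ring_nf
      calc _ ≤ (1 + L * a j) * (‖Z‖ + η) + 1 * (L * b * a j ^ 2) := by linarith
        _ ≤ Real.exp (L * a j) * (Real.exp (L * τ) * (η + L * b * σ)) +
            Real.exp (L * (τ + a j)) * (L * b * a j ^ 2) := by gcongr
        _ = Real.exp (L * (τ + a j)) * (η + L * b * (σ + a j ^ 2)) := by rw [hexp]; ring
  refine le_trans ?_ (key n hmn le_rfl)
  have h1 := norm_add_le (x n - φ (clock a n - clock a m) - ∑ i ∈ Finset.Ico m n, e i)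
    (∑ i ∈ Finset.Ico m n, e i)
  rw [sub_add_cancel] at h1
  linarith [hη n hmn le_rfl]

/-- If the accumulated errors are small as long as the scheme stays in a large ball, then the scheme
never leaves that ball and keeps coming back to `S`. -/
theorem exists_mem_of_perturbed_euler (hL : LipschitzWith L h) {a : ℕ → ℝ} (ha : ∀ n, 0 ≤ a n)
    {x e : ℕ → EuclideanSpace ℝ (Fin d)} (hx : ∀ n, x (n + 1) = x n + a n • h (x n) + e n)
    {S A : Set (EuclideanSpace ℝ (Fin d))} {T R₀ R δ b η σ : ℝ} (hT : 0 ≤ T)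
    (hflow : ∀ y ∈ S, ∃ φ, φ 0 = y ∧ IsODESolution h φ ∧ (∀ t, 0 ≤ t → ‖φ t‖ ≤ R₀) ∧
      (∀ t, 0 ≤ t → ‖h (φ t)‖ ≤ b) ∧ ∀ t, T ≤ t → φ t ∈ A)
    (hδ : 0 ≤ δ) (hAS : Metric.thickening δ A ⊆ S) (hR : R₀ + δ ≤ R) {n₀ : ℕ}
    (ha1 : ∀ n, n₀ ≤ n → a n ≤ 1)
    (herr : ∀ n, n₀ ≤ n → (∀ j, n₀ ≤ j → j ≤ n → ‖x j‖ ≤ R) →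
      ∀ m j, n₀ ≤ m → m ≤ j → j ≤ n + 1 → ‖∑ i ∈ Finset.Ico m j, e i‖ ≤ η)
    (hσ : ∀ m j, n₀ ≤ m → ∑ i ∈ Finset.Ico m j, a i ^ 2 ≤ σ)
    (hsmall : Real.exp (L * (T + 1)) * (η + L * b * σ) < δ) (h0 : x n₀ ∈ S) {n : ℕ}
    (hn : n₀ ≤ n) :
    ‖x n‖ ≤ R ∧ ∃ m, n₀ ≤ m ∧ m ≤ n ∧ x m ∈ S ∧ clock a n - clock a m ≤ T + 1 := by
  have hSR : ∀ y ∈ S, ‖y‖ ≤ R := by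
    intro y hy
    obtain ⟨φ, hφ0, -, hφR, -⟩ := hflow y hy
    have := hφR 0 le_rfl
    rw [hφ0] at this
    linarith
  have hclock : Monotone (clock a) :=
    monotone_nat_of_le_succ fun n => by rw [clock_succ]; linarith [ha n]
  -- The error bound is available only while the whole past is in the ball, so the induction must
  -- carry the whole past.
  suffices ∀ n, n₀ ≤ n → (∀ j, n₀ ≤ j → j ≤ n → ‖x j‖ ≤ R) ∧
      ∃ m, n₀ ≤ m ∧ m ≤ n ∧ x m ∈ S ∧ clock a n - clock a m ≤ T + 1 from
    ⟨(this n hn).1 n hn le_rfl, (this n hn).2⟩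
  intro n hn
  induction n, hn using Nat.le_induction with
  | base =>
    refine ⟨fun j hj hj' => ?_, n₀, le_rfl, le_rfl, h0, by linarith [sub_self (clock a n₀)]⟩
    rw [le_antisymm hj' hj]
    exact hSR _ h0
  | succ n hn ih =>
    obtain ⟨hball, m, hm, hmn, hmS, hmT⟩ := ih
    have herr' := herr n hn hball
    have htrack : ∀ p q, n₀ ≤ p → p ≤ q → q ≤ n + 1 → x p ∈ S → clock a q - clock a p ≤ T + 1 →
        ‖x q‖ ≤ R ∧ (T ≤ clock a q - clock a p → x q ∈ S) := by
      intro p q hp hpq hq hpS hT1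
      obtain ⟨φ, hφ0, hφ, hφR, hφb, hφA⟩ := hflow _ hpS
      have hb0 : 0 ≤ b := (norm_nonneg _).trans (hφb 0 le_rfl)
      have hclk : 0 ≤ clock a q - clock a p := sub_nonneg.2 (hclock hpq)
      have h1 := norm_sub_trajectory_le hL ha hx hφ hφb hpq hφ0
        (fun j hj hjq => herr' p j hp hj (hjq.trans hq))
      have hη0 : 0 ≤ η := (norm_nonneg _).trans (herr' p p hp le_rfl (hpq.trans hq))
      have h2 : ‖x q - φ (clock a q - clock a p)‖ < δ := by
        refine h1.trans_lt (lt_of_le_of_lt ?_ hsmall)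
        gcongr
        exact hσ p q hp
      refine ⟨?_, fun hTq => hAS ?_⟩
      · have h3 := hφR _ hclk
        have h4 := norm_add_le (φ (clock a q - clock a p)) (x q - φ (clock a q - clock a p))
        rw [add_sub_cancel] at h4
        linarith
      · exact Metric.mem_thickening_iff.2 ⟨_, hφA _ hTq, by rwa [dist_eq_norm]⟩
    -- If less than `T` has elapsed since the visit `m`, one more step of length at most `1` still
    -- fits; otherwise tracking puts `x n` itself in `S`, and the window restarts at `n`.
    have hex : ∃ m, n₀ ≤ m ∧ m ≤ n ∧ x m ∈ S ∧ clock a (n + 1) - clock a m ≤ T + 1 := by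
      have han := ha1 n hn
      rcases le_total (clock a n - clock a m) T with hle | hle
      · exact ⟨m, hm, hmn, hmS, by rw [clock_succ]; linarith⟩
      · exact ⟨n, hn, le_rfl, (htrack m n hm hmn (by omega) hmS hmT).2 hle,
          by rw [clock_succ]; linarith⟩
    obtain ⟨p, hp, hpn, hpS, hpT⟩ := hex
    refine ⟨fun j hj hj' => ?_, p, hp, by omega, hpS, hpT⟩
    rcases Nat.lt_or_ge j (n + 1) with hlt | hge
    · exact hball j hj (by omega)
    · rw [le_antisymm hj' hge]
      exact (htrack p (n + 1) hp (by omega) le_rfl hpS hpT).1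

/-- A perturbed Euler scheme that keeps coming back to `S` after bounded time and whose errors are
asymptotically negligible converges to every set that attracts `S` uniformly. -/
theorem tendsto_infDist_of_perturbed_euler (hL : LipschitzWith L h) {a : ℕ → ℝ}
    (ha : IsStepSize a) {x e : ℕ → EuclideanSpace ℝ (Fin d)}
    (hx : ∀ n, x (n + 1) = x n + a n • h (x n) + e n)
    {S H : Set (EuclideanSpace ℝ (Fin d))} {b T : ℝ}
    (hflow : ∀ ε, 0 < ε → ∃ T', ∀ y ∈ S, ∃ φ, φ 0 = y ∧ IsODESolution h φ ∧
      (∀ t, 0 ≤ t → ‖h (φ t)‖ ≤ b) ∧ ∀ t, 0 ≤ t → T' ≤ t → φ t ∈ Metric.thickening ε H)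
    (hH : H.Nonempty) (hb : 0 ≤ b)
    {n₀ : ℕ} (hret : ∀ n, n₀ ≤ n → ∃ m, n₀ ≤ m ∧ m ≤ n ∧ x m ∈ S ∧ clock a n - clock a m ≤ T)
    (herr : ∀ η, 0 < η → ∃ m₀, ∀ m j, m₀ ≤ m → m ≤ j → ‖∑ i ∈ Finset.Ico m j, e i‖ ≤ η) :
    Tendsto (fun n => Metric.infDist (x n) H) atTop (𝓝 0) := by
  have hT0 : 0 ≤ T := by
    obtain ⟨m, hm, hmn, -, hT⟩ := hret n₀ le_rfl
    rw [le_antisymm hmn hm, sub_self] at hT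
    exact hT
  refine Metric.tendsto_atTop.2 fun ε hε => ?_
  obtain ⟨T₁, hT₁⟩ := hflow (ε / 2) (half_pos hε)
  obtain ⟨T', hT'0, hT'⟩ : ∃ T', 0 ≤ T' ∧ T₁ ≤ T' := ⟨max 0 T₁, le_max_left _ _, le_max_right _ _⟩
  set κ := Real.exp (L * (T' + T + 1)) with hκ
  have hκ0 : 0 < κ := Real.exp_pos _
  obtain ⟨m₁, hm₁⟩ := herr (ε / 8 / κ) (by positivity)
  have hlim : Tendsto (fun m => κ * (L * b * tailSq a m)) atTop (𝓝 0) := by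
    simpa using ((tendsto_tailSq a).const_mul (L * b : ℝ)).const_mul κ
  obtain ⟨m₂, hm₂⟩ := eventually_atTop.1 (hlim.eventually (gt_mem_nhds (show 0 < ε / 8 by linarith)))
  obtain ⟨m₃, hm₃⟩ := eventually_atTop.1 (ha.tendsto_zero.eventually (ge_mem_nhds one_pos))
  obtain ⟨m₀, hm₀1, hm₀2, hm₀3, hm₀n⟩ : ∃ m₀, m₁ ≤ m₀ ∧ m₂ ≤ m₀ ∧ m₃ ≤ m₀ ∧ n₀ ≤ m₀ :=
    ⟨m₁ + m₂ + m₃ + n₀, by omega, by omega, by omega, by omega⟩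
  obtain ⟨N, hN⟩ := eventually_atTop.1
    (ha.tendsto_clock.eventually_ge_atTop (clock a m₀ + T' + T + 1))
  refine ⟨N, fun n hn => ?_⟩
  have hclk := hN n hn
  have hmono := ha.clock_strictMono.monotone
  -- Go back from `n` by time `T'`, then to the preceding visit `m` to `S`. The elapsed time is then
  -- between `T'` and `T' + T + 1`: long enough for attraction, and short enough for the Grönwall
  -- factor `κ`.
  obtain ⟨p, hpn, hp1, hp2⟩ : ∃ p, p ≤ n ∧ clock a p ≤ clock a n - T' ∧
      (p = n ∨ clock a n - T' < clock a (p + 1)) := by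
    classical
    refine ⟨Nat.findGreatest (fun p => clock a p ≤ clock a n - T') n, Nat.findGreatest_le n,
      Nat.findGreatest_spec (P := fun p => clock a p ≤ clock a n - T') (m := m₀) ?_ (by linarith),
      ?_⟩
    · by_contra! hlt
      linarith [hmono hlt.le]
    · rcases Nat.lt_or_ge (Nat.findGreatest (fun p => clock a p ≤ clock a n - T') n) n with hlt | hge
      · exact Or.inr (not_le.1 (Nat.findGreatest_is_greatest (Nat.lt_succ_self _) hlt))
      · exact Or.inl (le_antisymm (Nat.findGreatest_le n) hge)
  have hp3 : clock a n - T' - 1 ≤ clock a p ∧ m₀ ≤ p := by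
    rcases hp2 with rfl | hp2
    · refine ⟨by linarith, ?_⟩
      by_contra! hlt
      linarith [hmono hlt.le]
    · have hmp : m₀ ≤ p := by
        by_contra! hlt
        linarith [hmono (Nat.succ_le_of_lt hlt)]
      have := hm₃ p (hm₀3.trans hmp)
      rw [clock_succ] at hp2
      exact ⟨by linarith, hmp⟩
  obtain ⟨m, hm, hmp, hmS, hmT⟩ := hret p (hm₀n.trans hp3.2)
  have hm₀m : m₀ ≤ m := by
    by_contra! hlt
    have := ha.clock_strictMono hlt
    linarith [hp3.1]
  obtain ⟨φ, hφ0, hφ, hφb, hφH⟩ := hT₁ _ hmS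
  have htrack := norm_sub_trajectory_le hL (fun n => (ha.pos n).le) hx hφ hφb (hmp.trans hpn) hφ0
    (fun j hj _ => hm₁ m j (hm₀1.trans hm₀m) hj)
  have hpm := hmono hmp
  have hle : ‖x n - φ (clock a n - clock a m)‖ ≤ ε / 4 := by
    refine htrack.trans ?_
    have h1 : Real.exp (L * (clock a n - clock a m)) ≤ κ := by
      apply Real.exp_le_exp.2
      gcongr
      linarith [hp3.1]
    have h2 := hm₂ m₀ hm₀2
    calc _ ≤ κ * (ε / 8 / κ + L * b * tailSq a m₀) := by
            gcongr
            exact ha.sum_Ico_le_tailSq hm₀m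
      _ = ε / 8 + κ * (L * b * tailSq a m₀) := by field_simp
      _ ≤ ε / 4 := by linarith
  have hmem := (Metric.mem_thickening_iff_infDist_lt hH).1
    (hφH (clock a n - clock a m) (by linarith) (by linarith))
  rw [Real.dist_eq, sub_zero, abs_of_nonneg Metric.infDist_nonneg]
  have := Metric.infDist_le_infDist_add_dist (s := H) (x := x n) (y := φ (clock a n - clock a m))
  rw [dist_eq_norm] at this
  linarith

end PerturbedEuler

/-! ### Martingales with bounded increments -/

/-- `D` is a martingale difference sequence whose `n`-th term is bounded by `b n`. -/
structure IsBoundedMartingaleDifference {Ω E : Type*} {mΩ : MeasurableSpace Ω}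
    [NormedAddCommGroup E] [NormedSpace ℝ E] [CompleteSpace E]
    (μ : Measure Ω) (ℱ : Filtration ℕ mΩ) (D : ℕ → Ω → E) (b : ℕ → ℝ) : Prop where
  stronglyMeasurable : ∀ n, StronglyMeasurable[ℱ (n + 1)] (D n)
  norm_le : ∀ n, ∀ᵐ ω ∂μ, ‖D n ω‖ ≤ b n
  condExp_eq_zero : ∀ n, μ[D n | ℱ n] =ᵐ[μ] 0

namespace IsBoundedMartingaleDifference

section General

variable {Ω E : Type*} {mΩ : MeasurableSpace Ω} [NormedAddCommGroup E] [NormedSpace ℝ E]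
  [CompleteSpace E] {μ : Measure Ω} {ℱ : Filtration ℕ mΩ} {D : ℕ → Ω → E} {b : ℕ → ℝ}

theorem stronglyMeasurable_sum (hD : IsBoundedMartingaleDifference μ ℱ D b) (n : ℕ) :
    StronglyMeasurable[ℱ n] fun ω => ∑ i ∈ Finset.range n, D i ω :=
  Finset.stronglyMeasurable_fun_sum _ fun i hi =>
    (hD.stronglyMeasurable i).mono (ℱ.mono (Finset.mem_range.1 hi))

variable [IsProbabilityMeasure μ]

theorem bound_nonneg (hD : IsBoundedMartingaleDifference μ ℱ D b) (n : ℕ) : 0 ≤ b n := by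
  obtain ⟨ω, hω⟩ := (hD.norm_le n).exists
  exact (norm_nonneg _).trans hω

theorem integrable (hD : IsBoundedMartingaleDifference μ ℱ D b) (n : ℕ) : Integrable (D n) μ :=
  .of_bound ((hD.stronglyMeasurable n).mono (ℱ.le _)).aestronglyMeasurable _ (hD.norm_le n)

/-- Applied to the coordinate projections and to negation, this reduces vector estimates to
one-sided scalar ones. -/
theorem comp_continuousLinearMap (hD : IsBoundedMartingaleDifference μ ℱ D b)
    {F : Type*} [NormedAddCommGroup F] [NormedSpace ℝ F] [CompleteSpace F] (T : E →L[ℝ] F)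
    (hT : ∀ x, ‖T x‖ ≤ ‖x‖) :
    IsBoundedMartingaleDifference μ ℱ (fun n ω => T (D n ω)) b where
  stronglyMeasurable n := T.continuous.comp_stronglyMeasurable (hD.stronglyMeasurable n)
  norm_le n := by
    filter_upwards [hD.norm_le n] with ω hω using (hT _).trans hω
  condExp_eq_zero n := by
    filter_upwards [T.comp_condExp_comm (m := ℱ n) (hD.integrable n), hD.condExp_eq_zero n]
      with ω h1 h2
    have h3 : (μ[fun ω => T (D n ω) | ℱ n]) ω = T ((μ[D n | ℱ n]) ω) := h1.symm
    rw [h3, h2]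
    simp

end General

/-! ### Scalar case: exponential moments, maximal inequality and convergence. -/

section Real

variable {Ω : Type*} {mΩ : MeasurableSpace Ω} {μ : Measure Ω} {ℱ : Filtration ℕ mΩ}
  {D : ℕ → Ω → ℝ} {b : ℕ → ℝ}

theorem stronglyMeasurable_exp (hD : IsBoundedMartingaleDifference μ ℱ D b) (l : ℝ) (n : ℕ) :
    StronglyMeasurable[ℱ n] fun ω => Real.exp (l * ∑ i ∈ Finset.range n, D i ω) :=
  Real.continuous_exp.comp_stronglyMeasurable ((hD.stronglyMeasurable_sum n).const_mul l)

theorem ae_norm_exp_le (hD : IsBoundedMartingaleDifference μ ℱ D b) (l : ℝ) (n : ℕ) :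
    ∀ᵐ ω ∂μ, ‖Real.exp (l * ∑ i ∈ Finset.range n, D i ω)‖ ≤
      Real.exp (|l| * ∑ i ∈ Finset.range n, b i) := by
  filter_upwards [ae_all_iff.2 hD.norm_le] with ω hω
  rw [Real.norm_of_nonneg (Real.exp_pos _).le]
  refine Real.exp_le_exp.2 ((le_abs_self _).trans ?_)
  rw [abs_mul]
  gcongr
  exact (Finset.abs_sum_le_sum_abs _ _).trans (Finset.sum_le_sum fun i _ => hω i)

variable [IsProbabilityMeasure μ]

theorem neg (hD : IsBoundedMartingaleDifference μ ℱ D b) :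
    IsBoundedMartingaleDifference μ ℱ (fun n ω => -D n ω) b :=
  hD.comp_continuousLinearMap (-ContinuousLinearMap.id ℝ ℝ) fun x => by simp

theorem integral_mul_eq_zero (hD : IsBoundedMartingaleDifference μ ℱ D b) {n : ℕ} {g : Ω → ℝ}
    (hg : StronglyMeasurable[ℱ n] g) {c : ℝ} (hgc : ∀ᵐ ω ∂μ, ‖g ω‖ ≤ c) :
    ∫ ω, g ω * D n ω ∂μ = 0 := by
  have h1 := condExp_stronglyMeasurable_mul_of_bound (ℱ.le n) hg (hD.integrable n) c hgc
  calc ∫ ω, g ω * D n ω ∂μ = ∫ ω, (μ[g * D n | ℱ n]) ω ∂μ := (integral_condExp (ℱ.le n)).symm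
    _ = ∫ _, (0 : ℝ) ∂μ := by
      refine integral_congr_ae ?_
      filter_upwards [h1, hD.condExp_eq_zero n] with ω h2 h3
      rw [h2, Pi.mul_apply, h3]
      simp
    _ = 0 := integral_zero _ _

theorem integrable_exp (hD : IsBoundedMartingaleDifference μ ℱ D b) (l : ℝ) (n : ℕ) :
    Integrable (fun ω => Real.exp (l * ∑ i ∈ Finset.range n, D i ω)) μ :=
  .of_bound ((hD.stronglyMeasurable_exp l n).mono (ℱ.le _)).aestronglyMeasurable _
    (hD.ae_norm_exp_le l n)

theorem integrable_exp_mul (hD : IsBoundedMartingaleDifference μ ℱ D b) (l : ℝ) (n : ℕ) :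
    Integrable (fun ω => Real.exp (l * ∑ i ∈ Finset.range n, D i ω) * D n ω) μ :=
  (hD.integrable n).bdd_mul
    ((hD.stronglyMeasurable_exp l n).mono (ℱ.le _)).aestronglyMeasurable (hD.ae_norm_exp_le l n)

/-- Hoeffding's argument: by convexity `exp` lies below its chord on `[-l b, l b]`. The linear term
of the chord integrates to zero against the past, and `cosh x ≤ exp (x² / 2)` bounds the constant
term. -/
theorem integral_exp_succ_le (hD : IsBoundedMartingaleDifference μ ℱ D b) (l : ℝ) (n : ℕ) :
    ∫ ω, Real.exp (l * ∑ i ∈ Finset.range (n + 1), D i ω) ∂μ ≤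
      Real.exp (l ^ 2 * b n ^ 2 / 2) * ∫ ω, Real.exp (l * ∑ i ∈ Finset.range n, D i ω) ∂μ := by
  have h1 := hD.integrable_exp l n
  have h2 := hD.integrable_exp_mul l n
  have hle : ∫ ω, Real.exp (l * ∑ i ∈ Finset.range (n + 1), D i ω) ∂μ ≤
      ∫ ω, (Real.cosh (l * b n) * Real.exp (l * ∑ i ∈ Finset.range n, D i ω) +
        Real.sinh (l * b n) / b n *
          (Real.exp (l * ∑ i ∈ Finset.range n, D i ω) * D n ω)) ∂μ := by
    refine integral_mono_ae (hD.integrable_exp l (n + 1))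
      ((h1.const_mul _).add (h2.const_mul _)) ?_
    filter_upwards [hD.norm_le n] with ω hω
    rw [Real.norm_eq_abs] at hω
    have hb := hD.bound_nonneg n
    have ht : |D n ω / b n| ≤ 1 := by
      rw [abs_div, abs_of_nonneg hb]
      exact div_le_one_of_le₀ hω hb
    have h3 := Real.exp_mul_le_cosh_add_mul_sinh ht (l * b n)
    -- If `b n = 0` the quotient is `0` by convention, but then `D n ω` vanishes too.
    have h4 : D n ω / b n * (l * b n) = l * D n ω := by
      rcases hb.eq_or_lt with h0 | h0
      · rw [← h0] at hω
        have : D n ω = 0 := abs_nonpos_iff.1 hω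
        simp [this]
      · field_simp
    rw [h4] at h3
    rw [Finset.sum_range_succ, mul_add, Real.exp_add]
    calc _ ≤ Real.exp (l * ∑ i ∈ Finset.range n, D i ω) *
          (Real.cosh (l * b n) + D n ω / b n * Real.sinh (l * b n)) := by gcongr
      _ = _ := by ring
  refine hle.trans ?_
  rw [integral_add (h1.const_mul _) (h2.const_mul _), integral_const_mul, integral_const_mul,
    hD.integral_mul_eq_zero (hD.stronglyMeasurable_exp l n) (hD.ae_norm_exp_le l n), mul_zero,
    add_zero]
  have h5 : 0 ≤ ∫ ω, Real.exp (l * ∑ i ∈ Finset.range n, D i ω) ∂μ :=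
    integral_nonneg fun ω => (Real.exp_pos _).le
  gcongr
  refine (Real.cosh_le_exp_half_sq _).trans (le_of_eq ?_)
  rw [mul_pow]

theorem integral_exp_le (hD : IsBoundedMartingaleDifference μ ℱ D b) (l : ℝ) (n : ℕ) :
    ∫ ω, Real.exp (l * ∑ i ∈ Finset.range n, D i ω) ∂μ ≤
      Real.exp (l ^ 2 * (∑ i ∈ Finset.range n, b i ^ 2) / 2) := by
  induction n with
  | zero => simp
  | succ n ih =>
    refine (hD.integral_exp_succ_le l n).trans ?_
    calc _ ≤ Real.exp (l ^ 2 * b n ^ 2 / 2) *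
          Real.exp (l ^ 2 * (∑ i ∈ Finset.range n, b i ^ 2) / 2) := by gcongr
      _ = _ := by
        rw [← Real.exp_add, Finset.sum_range_succ]
        ring_nf

/-- From `exp x ≥ 1 + x`, whose linear term has zero mean on events of the past. This is what lets
Doob's maximal inequality apply. -/
theorem submartingale_exp (hD : IsBoundedMartingaleDifference μ ℱ D b) (l : ℝ) :
    Submartingale (fun n ω => Real.exp (l * ∑ i ∈ Finset.range n, D i ω)) ℱ μ := by
  refine submartingale_of_setIntegral_le_succ (fun n => hD.stronglyMeasurable_exp l n)
    (fun n => hD.integrable_exp l n) fun n s hs => ?_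
  have h1 := (hD.integrable_exp l n).integrableOn (s := s)
  have h2 := (hD.integrable_exp_mul l n).integrableOn (s := s)
  have hle : ∫ ω in s, (Real.exp (l * ∑ i ∈ Finset.range n, D i ω) +
      l * (Real.exp (l * ∑ i ∈ Finset.range n, D i ω) * D n ω)) ∂μ ≤
      ∫ ω in s, Real.exp (l * ∑ i ∈ Finset.range (n + 1), D i ω) ∂μ := by
    refine integral_mono (h1.add (h2.const_mul l)) (hD.integrable_exp l (n + 1)).integrableOn
      fun ω => ?_
    dsimp only
    rw [Finset.sum_range_succ, mul_add, Real.exp_add]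
    have h3 := Real.add_one_le_exp (l * D n ω)
    calc _ = Real.exp (l * ∑ i ∈ Finset.range n, D i ω) * (l * D n ω + 1) := by ring
      _ ≤ _ := by gcongr
  have hz : ∫ ω in s, Real.exp (l * ∑ i ∈ Finset.range n, D i ω) * D n ω ∂μ = 0 := by
    rw [← integral_indicator (ℱ.le n s hs), ← hD.integral_mul_eq_zero
      ((hD.stronglyMeasurable_exp l n).indicator hs)
      (c := Real.exp (|l| * ∑ i ∈ Finset.range n, b i))
      (by
        filter_upwards [hD.ae_norm_exp_le l n] with ω hω
        exact (norm_indicator_le_norm_self _ _).trans hω)]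
    congr 1 with ω
    by_cases hω : ω ∈ s <;> simp [hω]
  rw [integral_add h1 (h2.const_mul l), integral_const_mul, hz, mul_zero, add_zero] at hle
  exact hle

theorem measure_exists_lt_le (hD : IsBoundedMartingaleDifference μ ℱ D b) {σ : ℝ} (hσ0 : 0 < σ)
    (hσ : ∀ n, ∑ i ∈ Finset.range n, b i ^ 2 ≤ σ) {η : ℝ} (hη : 0 ≤ η) (n : ℕ) :
    μ {ω | ∃ k < n, η ≤ ∑ i ∈ Finset.range k, D i ω} ≤
      ENNReal.ofReal (Real.exp (-η ^ 2 / (2 * σ))) := by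
  -- The minimiser of the Chernoff exponent `l² σ / 2 - l η`.
  set l := η / σ with hl
  have hl0 : 0 ≤ l := div_nonneg hη hσ0.le
  have hmax := maximal_ineq (hD.submartingale_exp l) (fun n ω => (Real.exp_pos _).le)
    (ε := (Real.exp (l * η)).toNNReal) n
  rw [Real.coe_toNNReal _ (Real.exp_pos _).le] at hmax
  set W := {ω | Real.exp (l * η) ≤
    (Finset.range (n + 1)).sup' Finset.nonempty_range_add_one
      fun k => Real.exp (l * ∑ i ∈ Finset.range k, D i ω)} with hW
  have hsub : {ω | ∃ k < n, η ≤ ∑ i ∈ Finset.range k, D i ω} ⊆ W := by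
    rintro ω ⟨k, hk, hkη⟩
    have h1 : Real.exp (l * η) ≤ Real.exp (l * ∑ i ∈ Finset.range k, D i ω) :=
      Real.exp_le_exp.2 (mul_le_mul_of_nonneg_left hkη hl0)
    exact h1.trans (Finset.le_sup' (fun k => Real.exp (l * ∑ i ∈ Finset.range k, D i ω))
      (Finset.mem_range.2 (by omega)))
  refine (measure_mono hsub).trans ?_
  have hint : ∫ ω in W, Real.exp (l * ∑ i ∈ Finset.range n, D i ω) ∂μ ≤
      Real.exp (l ^ 2 * σ / 2) := by
    refine (setIntegral_le_integral (hD.integrable_exp l n)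
      (Eventually.of_forall fun ω => (Real.exp_pos _).le)).trans
      ((hD.integral_exp_le l n).trans ?_)
    gcongr
    exact hσ n
  have h2 : ENNReal.ofReal (Real.exp (l * η)) * μ W ≤ _ := hmax.trans (ENNReal.ofReal_le_ofReal hint)
  have h3 : Real.exp (-η ^ 2 / (2 * σ)) = Real.exp (l ^ 2 * σ / 2) / Real.exp (l * η) := by
    rw [← Real.exp_sub, hl]
    congr 1
    field_simp
    ring
  rw [h3, ENNReal.ofReal_div_of_pos (Real.exp_pos _)]
  rw [ENNReal.le_div_iff_mul_le (Or.inl (by simp [Real.exp_pos])) (Or.inl ENNReal.ofReal_ne_top),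
    mul_comm]
  exact h2

/-- The maximal form of the Azuma-Hoeffding inequality. -/
theorem measure_exists_le (hD : IsBoundedMartingaleDifference μ ℱ D b) {σ : ℝ} (hσ0 : 0 < σ)
    (hσ : ∀ n, ∑ i ∈ Finset.range n, b i ^ 2 ≤ σ) {η : ℝ} (hη : 0 ≤ η) :
    μ {ω | ∃ k, η ≤ ∑ i ∈ Finset.range k, D i ω} ≤
      ENNReal.ofReal (Real.exp (-η ^ 2 / (2 * σ))) := by
  have hU : {ω | ∃ k, η ≤ ∑ i ∈ Finset.range k, D i ω} =
      ⋃ n : ℕ, {ω | ∃ k < n, η ≤ ∑ i ∈ Finset.range k, D i ω} := by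
    ext ω
    simp only [Set.mem_ofPred_eq, Set.mem_iUnion]
    exact ⟨fun ⟨k, hk⟩ => ⟨k + 1, k, k.lt_succ_self, hk⟩, fun ⟨_, k, _, hk⟩ => ⟨k, hk⟩⟩
  have hmono : Monotone fun n : ℕ => {ω | ∃ k < n, η ≤ ∑ i ∈ Finset.range k, D i ω} :=
    fun n m hnm ω ⟨k, hk, hkη⟩ => ⟨k, hk.trans_le hnm, hkη⟩
  rw [hU, hmono.measure_iUnion]
  exact iSup_le fun n => hD.measure_exists_lt_le hσ0 hσ hη n

theorem measure_exists_le_abs (hD : IsBoundedMartingaleDifference μ ℱ D b) {σ : ℝ} (hσ0 : 0 < σ)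
    (hσ : ∀ n, ∑ i ∈ Finset.range n, b i ^ 2 ≤ σ) {η : ℝ} (hη : 0 ≤ η) :
    μ {ω | ∃ k, η ≤ |∑ i ∈ Finset.range k, D i ω|} ≤
      2 * ENNReal.ofReal (Real.exp (-η ^ 2 / (2 * σ))) := by
  have hsub : {ω | ∃ k, η ≤ |∑ i ∈ Finset.range k, D i ω|} ⊆
      {ω | ∃ k, η ≤ ∑ i ∈ Finset.range k, D i ω} ∪
        {ω | ∃ k, η ≤ ∑ i ∈ Finset.range k, -D i ω} := by
    rintro ω ⟨k, hk⟩
    rcases le_abs.1 hk with h | h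
    · exact Or.inl ⟨k, h⟩
    · exact Or.inr ⟨k, by rwa [Finset.sum_neg_distrib]⟩
  refine (measure_mono hsub).trans ((measure_union_le _ _).trans ?_)
  rw [two_mul]
  exact add_le_add (hD.measure_exists_le hσ0 hσ hη) (hD.neg.measure_exists_le hσ0 hσ hη)

theorem martingale_sum (hD : IsBoundedMartingaleDifference μ ℱ D b) :
    Martingale (fun n ω => ∑ i ∈ Finset.range n, D i ω) ℱ μ := by
  refine martingale_of_condExp_sub_eq_zero_nat (fun n => hD.stronglyMeasurable_sum n)
    (fun n => integrable_finsetSum _ fun i _ => hD.integrable i) fun n => ?_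
  have : ((fun ω => ∑ i ∈ Finset.range (n + 1), D i ω) - fun ω => ∑ i ∈ Finset.range n, D i ω)
      = D n := by
    ext ω
    simp [Finset.sum_range_succ]
  rw [this]
  exact hD.condExp_eq_zero n

/-- Since `|u| ≤ exp u + exp (-u)`, the exponential moments at `l = ±1` bound the martingale in
`L¹`, and martingale convergence applies. -/
theorem ae_exists_tendsto (hD : IsBoundedMartingaleDifference μ ℱ D b) {σ : ℝ}
    (hσ : ∀ n, ∑ i ∈ Finset.range n, b i ^ 2 ≤ σ) :
    ∀ᵐ ω ∂μ, ∃ c, Tendsto (fun n => ∑ i ∈ Finset.range n, D i ω) atTop (𝓝 c) := by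
  have hbdd : ∀ n, eLpNorm (fun ω => ∑ i ∈ Finset.range n, D i ω) 1 μ ≤
      ((2 * Real.exp (σ / 2)).toNNReal : ℝ≥0∞) := by
    intro n
    have hint : Integrable (fun ω => ∑ i ∈ Finset.range n, D i ω) μ :=
      integrable_finsetSum _ fun i _ => hD.integrable i
    have hle : ∫ ω, ‖∑ i ∈ Finset.range n, D i ω‖ ∂μ ≤ 2 * Real.exp (σ / 2) := by
      have e1 := hD.integral_exp_le 1 n
      have e2 := hD.integral_exp_le (-1) n
      have hσn := hσ n
      have e3 : Real.exp ((1 : ℝ) ^ 2 * (∑ i ∈ Finset.range n, b i ^ 2) / 2) ≤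
          Real.exp (σ / 2) := Real.exp_le_exp.2 (by linarith)
      have e4 : Real.exp ((-1 : ℝ) ^ 2 * (∑ i ∈ Finset.range n, b i ^ 2) / 2) ≤
          Real.exp (σ / 2) := Real.exp_le_exp.2 (by linarith)
      have e5 : ∫ ω, ‖∑ i ∈ Finset.range n, D i ω‖ ∂μ ≤
          ∫ ω, (Real.exp (1 * ∑ i ∈ Finset.range n, D i ω) +
            Real.exp ((-1) * ∑ i ∈ Finset.range n, D i ω)) ∂μ := by
        refine integral_mono hint.norm ((hD.integrable_exp 1 n).add (hD.integrable_exp (-1) n))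
          fun ω => ?_
        dsimp only
        rw [one_mul, neg_one_mul, Real.norm_eq_abs]
        set u := ∑ i ∈ Finset.range n, D i ω
        have p1 := Real.add_one_le_exp u
        have p2 := Real.add_one_le_exp (-u)
        have p3 := Real.exp_pos u
        have p4 := Real.exp_pos (-u)
        rcases abs_cases u with ⟨hu, -⟩ | ⟨hu, -⟩ <;> rw [hu] <;> linarith
      rw [integral_add (hD.integrable_exp 1 n) (hD.integrable_exp (-1) n)] at e5
      linarith
    rw [eLpNorm_one_eq_lintegral_enorm, ← ofReal_integral_norm_eq_lintegral_enorm hint]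
    exact ENNReal.ofReal_le_ofReal hle
  filter_upwards [hD.martingale_sum.submartingale.ae_tendsto_limitProcess hbdd] with ω hω
  exact ⟨_, hω⟩

end Real

/-! ### Vector case, by coordinates. -/

section Euclidean

variable {Ω : Type*} {mΩ : MeasurableSpace Ω} {μ : Measure Ω} [IsProbabilityMeasure μ]
  {ℱ : Filtration ℕ mΩ} {d : ℕ} {D : ℕ → Ω → EuclideanSpace ℝ (Fin d)} {b : ℕ → ℝ}

theorem coord (hD : IsBoundedMartingaleDifference μ ℱ D b) (i : Fin d) :
    IsBoundedMartingaleDifference μ ℱ (fun n ω => D n ω i) b :=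
  hD.comp_continuousLinearMap (EuclideanSpace.proj i) fun x => PiLp.norm_apply_le x i

/-- A vector of norm at least `η` has a coordinate of size at least `η / √d`. The union over
coordinates and signs produces the factor `2 * d`, and the threshold puts `d` in the exponent. For
`d = 0` the event is empty because `η > 0`. -/
theorem measure_exists_le_norm (hD : IsBoundedMartingaleDifference μ ℱ D b) {σ : ℝ}
    (hσ0 : 0 < σ) (hσ : ∀ n, ∑ i ∈ Finset.range n, b i ^ 2 ≤ σ) {η : ℝ} (hη : 0 < η) :
    μ {ω | ∃ k, η ≤ ‖∑ i ∈ Finset.range k, D i ω‖} ≤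
      ENNReal.ofReal (2 * d * Real.exp (-η ^ 2 / (2 * d * σ))) := by
  have hsub : {ω | ∃ k, η ≤ ‖∑ i ∈ Finset.range k, D i ω‖} ⊆
      ⋃ j : Fin d, {ω | ∃ k, η / √d ≤ |∑ i ∈ Finset.range k, D i ω j|} := by
    rintro ω ⟨k, hk⟩
    by_contra hcon
    simp only [Set.mem_iUnion, Set.mem_ofPred_eq, not_exists, not_le] at hcon
    rcases Nat.eq_zero_or_pos d with rfl | hd
    · rw [Subsingleton.elim (∑ i ∈ Finset.range k, D i ω) 0, norm_zero] at hk
      linarith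
    · have hd' : (0 : ℝ) < d := Nat.cast_pos.2 hd
      have : Nonempty (Fin d) := ⟨⟨0, hd⟩⟩
      have h1 : ‖∑ i ∈ Finset.range k, D i ω‖ ^ 2 < η ^ 2 := by
        rw [EuclideanSpace.norm_sq_eq]
        calc _ < ∑ _j : Fin d, η ^ 2 / d := by
              refine Finset.sum_lt_sum_of_nonempty Finset.univ_nonempty fun j _ => ?_
              have h2 := hcon j k
              have h3 : (∑ i ∈ Finset.range k, D i ω) j = ∑ i ∈ Finset.range k, D i ω j := by
                simp
              rw [h3, Real.norm_eq_abs]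
              calc _ < (η / √d) ^ 2 := by gcongr
                _ = η ^ 2 / d := by rw [div_pow, Real.sq_sqrt hd'.le]
          _ = η ^ 2 := by
              rw [Finset.sum_const, Finset.card_univ, Fintype.card_fin, nsmul_eq_mul]
              field_simp
      exact absurd (lt_of_pow_lt_pow_left₀ 2 hη.le h1) (not_lt.2 hk)
  refine (measure_mono hsub).trans ((measure_iUnion_fintype_le _ _).trans ?_)
  have hj : ∀ j : Fin d, μ {ω | ∃ k, η / √d ≤ |∑ i ∈ Finset.range k, D i ω j|} ≤
      2 * ENNReal.ofReal (Real.exp (-η ^ 2 / (2 * d * σ))) := by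
    intro j
    refine ((hD.coord j).measure_exists_le_abs hσ0 hσ (by positivity)).trans (le_of_eq ?_)
    rw [div_pow, Real.sq_sqrt (Nat.cast_nonneg d), neg_div, neg_div, div_div]
    ring_nf
  refine (Finset.sum_le_sum fun j _ => hj j).trans (le_of_eq ?_)
  rw [Finset.sum_const, Finset.card_univ, Fintype.card_fin, nsmul_eq_mul,
    ENNReal.ofReal_mul (by positivity), ENNReal.ofReal_mul (by norm_num), ENNReal.ofReal_natCast,
    ENNReal.ofReal_ofNat]
  ring

theorem ae_cauchySeq (hD : IsBoundedMartingaleDifference μ ℱ D b) {σ : ℝ}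
    (hσ : ∀ n, ∑ i ∈ Finset.range n, b i ^ 2 ≤ σ) :
    ∀ᵐ ω ∂μ, CauchySeq fun n => ∑ i ∈ Finset.range n, D i ω := by
  filter_upwards [ae_all_iff.2 fun j : Fin d => (hD.coord j).ae_exists_tendsto hσ] with ω hω
  choose c hc using hω
  have h1 : Tendsto (fun n => WithLp.ofLp (∑ i ∈ Finset.range n, D i ω)) atTop (𝓝 c) := by
    refine tendsto_pi_nhds.2 fun j => ?_
    simpa using hc j
  have h2 := ((PiLp.continuous_toLp 2 fun _ : Fin d => ℝ).tendsto c).comp h1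
  exact h2.cauchySeq

end Euclidean

end IsBoundedMartingaleDifference

/-! ### Conditional expectations -/

section CondExp

/-- A countably generated σ-algebra is generated by a countable π-system. -/
theorem exists_countable_isPiSystem (α : Type*) [mα : MeasurableSpace α]
    [MeasurableSpace.CountablyGenerated α] :
    ∃ S : Set (Set α), S.Countable ∧ IsPiSystem S ∧ mα = MeasurableSpace.generateFrom S := by
  classical
  set g := MeasurableSpace.natGeneratingSequence α with hg
  refine ⟨Set.range fun s : Finset ℕ => ⋂ i ∈ s, g i, Set.countable_range _, ?_, ?_⟩
  · rintro _ ⟨s, rfl⟩ _ ⟨t, rfl⟩ -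
    exact ⟨s ∪ t, Set.ext fun x => by simp [or_imp, forall_and]⟩
  · refine le_antisymm ?_ (MeasurableSpace.generateFrom_le ?_)
    · conv_lhs => rw [← MeasurableSpace.generateFrom_natGeneratingSequence α]
      refine MeasurableSpace.generateFrom_mono ?_
      rintro _ ⟨i, rfl⟩
      exact ⟨{i}, by simp [hg]⟩
    · rintro _ ⟨s, rfl⟩
      exact Finset.measurableSet_biInter s fun i _ =>
        MeasurableSpace.measurableSet_natGeneratingSequence i

/-- If the conditional law of `Z` given `X` is `κ`, tested on every measurable set, then conditional
expectations of functions of `(X, Z)` are integrals against `κ`; no measurability of `κ` is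
needed. -/
theorem condExp_prodMk_ae_eq_integral {Ω β γ E : Type*} {mΩ : MeasurableSpace Ω}
    {mβ : MeasurableSpace β} [MeasurableSpace γ] [StandardBorelSpace γ] [Nonempty γ]
    [NormedAddCommGroup E] [NormedSpace ℝ E] [CompleteSpace E] {P : Measure Ω}
    [IsProbabilityMeasure P] {X : Ω → β} (hX : Measurable X) {Z : Ω → γ} (hZ : Measurable Z)
    {κ : Ω → Measure γ} (hκ : ∀ ω, IsProbabilityMeasure (κ ω))
    (hκZ : ∀ A, MeasurableSet A → P[(Z ⁻¹' A).indicator (fun _ => (1 : ℝ)) | mβ.comap X]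
      =ᵐ[P] fun ω => (κ ω).real A)
    {F : β × γ → E} (hF : StronglyMeasurable F) (hint : Integrable (fun ω => F (X ω, Z ω)) P) :
    P[fun ω => F (X ω, Z ω) | mβ.comap X] =ᵐ[P] fun ω => ∫ z, F (X ω, z) ∂(κ ω) := by
  obtain ⟨S, hSc, hSpi, hS⟩ := exists_countable_isPiSystem γ
  have hmeas : ∀ A ∈ S, MeasurableSet A := fun A hA => by
    rw [hS]
    exact MeasurableSpace.measurableSet_generateFrom hA
  -- For each set the two laws agree off a null set depending on it; a countable generating π-system
  -- leaves a single null set.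
  have hκ' : ∀ᵐ ω ∂P, condDistrib Z X P (X ω) = κ ω := by
    have h1 : ∀ᵐ ω ∂P, ∀ A ∈ S, (condDistrib Z X P (X ω)).real A = (κ ω).real A := by
      refine (ae_ball_iff hSc).2 fun A hA => ?_
      exact (condDistrib_ae_eq_condExp hX hZ (hmeas A hA)).trans (hκZ A (hmeas A hA))
    filter_upwards [h1] with ω hω
    have := hκ ω
    refine ext_of_generate_finite S hS hSpi (fun A hA => ?_) (by simp)
    exact (measureReal_eq_measureReal_iff).1 (hω A hA)
  filter_upwards [condExp_prod_ae_eq_integral_condDistrib hX hZ.aemeasurable hF hint, hκ']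
    with ω h1 h2
  rw [h1, h2]

/-- As `s` is in `m`, integrating over `A` under `P[|s]` is, up to normalisation, integrating over
`A ∩ s` in `m` under `P`. Hence martingale differences survive conditioning on a past event. -/
theorem condExp_cond_ae_eq_zero {Ω E : Type*} {m mΩ : MeasurableSpace Ω} (hm : m ≤ mΩ)
    [NormedAddCommGroup E] [NormedSpace ℝ E] [CompleteSpace E] {P : Measure Ω}
    [IsProbabilityMeasure P] {s : Set Ω} (hs : MeasurableSet[m] s) (hs0 : P s ≠ 0) {X : Ω → E}
    (hX : Integrable X P) (h0 : P[X | m] =ᵐ[P] 0) : (P[|s])[X | m] =ᵐ[P[|s]] 0 := by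
  have := cond_isProbabilityMeasure hs0
  have hX' : Integrable X (P[|s]) :=
    hX.restrict.smul_measure (ENNReal.inv_ne_top.2 hs0)
  refine (ae_eq_condExp_of_forall_setIntegral_eq hm hX' (fun _ _ _ => integrableOn_zero)
    (fun A hA _ => ?_) aestronglyMeasurable_zero).symm
  have h1 : ∫ ω in A ∩ s, X ω ∂P = 0 := by
    rw [← setIntegral_condExp hm hX (hA.inter hs)]
    rw [setIntegral_congr_ae (g := fun _ => (0 : E)) (hm _ (hA.inter hs))
      (h0.mono fun ω hω _ => hω)]
    simp
  rw [integral_zero, ProbabilityTheory.cond, Measure.restrict_smul,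
    Measure.restrict_restrict (hm _ hA), integral_smul_measure, h1, smul_zero]

end CondExp

/-! ### The averaging model -/

namespace IsAveragingModel

variable {d k : ℕ}
  {f : EuclideanSpace ℝ (Fin d) → EuclideanSpace ℝ (Fin k) → EuclideanSpace ℝ (Fin d)}
  {Q : EuclideanSpace ℝ (Fin d) → Kernel (EuclideanSpace ℝ (Fin k)) (EuclideanSpace ℝ (Fin k))}
  {Γ : EuclideanSpace ℝ (Fin d) → Measure (EuclideanSpace ℝ (Fin k))}
  {v : EuclideanSpace ℝ (Fin d) → EuclideanSpace ℝ (Fin k) → EuclideanSpace ℝ (Fin d)}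
  {K : ℝ} {L : ℝ≥0} {C : ℝ → ℝ}

/-- A Carathéodory function: locally Lipschitz in `θ`, measurable in `y`. -/
theorem measurable_uncurry_v (hmodel : IsAveragingModel f Q Γ v K L C) :
    Measurable (Function.uncurry v) := by
  refine measurable_uncurry_of_continuous_of_measurable (fun y => ?_) hmodel.measurable_v
  refine continuous_iff_continuousAt.2 fun θ => ?_
  set R := ‖θ‖ + 1 with hR
  have hR0 : 0 < R := by positivity
  have hlip : LipschitzOnWith (C R * (1 + ‖y‖)).toNNReal (fun θ => v θ y)
      (Metric.closedBall 0 R) := by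
    refine LipschitzOnWith.of_dist_le_mul fun θ₁ h₁ θ₂ h₂ => ?_
    rw [mem_closedBall_zero_iff] at h₁ h₂
    rw [dist_eq_norm, dist_eq_norm]
    refine (hmodel.lipschitz_v R hR0 θ₁ θ₂ y h₁ h₂).trans ?_
    have := Real.le_coe_toNNReal (C R * (1 + ‖y‖))
    calc _ = C R * (1 + ‖y‖) * ‖θ₁ - θ₂‖ := by ring
      _ ≤ _ := by gcongr
  refine hlip.continuousOn.continuousAt (Filter.mem_of_superset
    (Metric.ball_mem_nhds θ one_pos) fun θ' hθ' => ?_)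
  rw [Metric.mem_ball, dist_eq_norm] at hθ'
  rw [mem_closedBall_zero_iff]
  have := norm_add_le θ (θ' - θ)
  rw [add_sub_cancel] at this
  linarith

theorem norm_meanField_le (hmodel : IsAveragingModel f Q Γ v K L C)
    (θ : EuclideanSpace ℝ (Fin d)) : ‖meanField f Γ θ‖ ≤ K * (1 + ‖θ‖) := by
  have := hmodel.prob θ
  have h1 := norm_integral_le_of_norm_le_const (μ := Γ θ) (f := f θ)
    (Eventually.of_forall fun y => hmodel.growth θ y)
  simpa [meanField] using h1

theorem K_nonneg (hmodel : IsAveragingModel f Q Γ v K L C) : 0 ≤ K := by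
  simpa using (norm_nonneg _).trans (hmodel.growth 0 0)

theorem norm_v_le (hmodel : IsAveragingModel f Q Γ v K L C) {R c : ℝ} (hR : 0 < R)
    {θ : EuclideanSpace ℝ (Fin d)} {y : EuclideanSpace ℝ (Fin k)} (hθ : ‖θ‖ ≤ R) (hy : ‖y‖ ≤ c) :
    ‖v θ y‖ ≤ |C R| * (1 + |c|) := by
  refine (hmodel.bound_v R hR θ y hθ).trans ?_
  gcongr
  · exact le_abs_self _
  · exact hy.trans (le_abs_self _)

/-- Summation by parts for the part of the averaging error that is not a martingale. -/
theorem norm_sum_v_sub_le (hmodel : IsAveragingModel f Q Γ v K L C) {R c β : ℝ} (hR : 0 < R)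
    {a : ℕ → ℝ} (ha0 : ∀ n, 0 ≤ a n) (ha : Antitone a)
    {θ : ℕ → EuclideanSpace ℝ (Fin d)} {y : ℕ → EuclideanSpace ℝ (Fin k)} {m n : ℕ} (hmn : m ≤ n)
    (hθ : ∀ j, m ≤ j → j ≤ n → ‖θ j‖ ≤ R) (hy : ∀ j, m ≤ j → ‖y j‖ ≤ c)
    (hβ : ∀ j, m ≤ j → j < n → ‖θ (j + 1) - θ j‖ ≤ a j * β) :
    ‖∑ j ∈ Finset.Ico m n, a j • (v (θ j) (y j) - v (θ j) (y (j + 1)))‖ ≤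
      |C R| * (1 + |c|) * (2 * a m + β * ∑ j ∈ Finset.Ico m n, a j ^ 2) := by
  set U := |C R| * (1 + |c|) with hU
  have hU0 : 0 ≤ U := by positivity
  have hv : ∀ j, m ≤ j → j ≤ n → ‖a j • v (θ j) (y j)‖ ≤ a j * U := by
    intro j hj hjn
    rw [norm_smul, Real.norm_of_nonneg (ha0 j)]
    exact mul_le_mul_of_nonneg_left (hmodel.norm_v_le hR (hθ j hj hjn) (hy j hj)) (ha0 j)
  -- The boundary term `a p • v (θ p) (y p)` completes the summation by parts. The `- a p` on the
  -- right absorbs the increments `a p - a (p + 1)`, which are nonnegative by monotonicity.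
  have key : ∀ p, m ≤ p → p ≤ n →
      ‖∑ j ∈ Finset.Ico m p, a j • (v (θ j) (y j) - v (θ j) (y (j + 1))) + a p • v (θ p) (y p)‖ ≤
        U * (2 * a m - a p + β * ∑ j ∈ Finset.Ico m p, a j ^ 2) := by
    intro p hp
    induction p, hp using Nat.le_induction with
    | base =>
      intro _
      have := hv m le_rfl hmn
      simp only [Finset.Ico_self, Finset.sum_empty, zero_add, mul_zero, add_zero]
      linarith
    | succ p hp ih =>
      intro hpn
      have ih := ih (by omega)
      rw [Finset.sum_Ico_succ_top hp, Finset.sum_Ico_succ_top hp]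
      have hdec : ∑ j ∈ Finset.Ico m p, a j • (v (θ j) (y j) - v (θ j) (y (j + 1))) +
            a p • (v (θ p) (y p) - v (θ p) (y (p + 1))) + a (p + 1) • v (θ (p + 1)) (y (p + 1)) =
          ((∑ j ∈ Finset.Ico m p, a j • (v (θ j) (y j) - v (θ j) (y (j + 1))) +
              a p • v (θ p) (y p)) +
            a p • (v (θ (p + 1)) (y (p + 1)) - v (θ p) (y (p + 1)))) -
          (a p - a (p + 1)) • v (θ (p + 1)) (y (p + 1)) := by
        simp only [smul_sub, sub_smul]
        abel
      have hap : 0 ≤ a p - a (p + 1) := sub_nonneg.2 (ha p.le_succ)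
      have h1 : ‖(a p - a (p + 1)) • v (θ (p + 1)) (y (p + 1))‖ ≤ (a p - a (p + 1)) * U := by
        rw [norm_smul, Real.norm_of_nonneg hap]
        exact mul_le_mul_of_nonneg_left
          (hmodel.norm_v_le hR (hθ _ (by omega) hpn) (hy _ (by omega))) hap
      have h2 : ‖a p • (v (θ (p + 1)) (y (p + 1)) - v (θ p) (y (p + 1)))‖ ≤
          a p * (U * (a p * β)) := by
        rw [norm_smul, Real.norm_of_nonneg (ha0 p)]
        refine mul_le_mul_of_nonneg_left ?_ (ha0 p)
        refine (hmodel.lipschitz_v R hR _ _ _ (hθ _ (by omega) hpn)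
          (hθ _ hp (by omega))).trans ?_
        have h3 := hβ p hp (by omega)
        have h4 : 1 + ‖y (p + 1)‖ ≤ 1 + |c| := by
          linarith [hy (p + 1) (by omega), le_abs_self c]
        calc _ ≤ |C R| * (a p * β) * (1 + |c|) := by
              gcongr
              · exact mul_nonneg (abs_nonneg _) ((norm_nonneg _).trans h3)
              · exact le_abs_self _
          _ = _ := by rw [hU]; ring
      rw [hdec]
      refine (norm_sub_le _ _).trans ((add_le_add ((norm_add_le _ _).trans
        (add_le_add ih h2)) h1).trans (le_of_eq ?_))
      ring
  have h1 := key n hmn le_rfl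
  have h2 := hv n hmn le_rfl
  have h3 := norm_sub_le (∑ j ∈ Finset.Ico m n, a j • (v (θ j) (y j) - v (θ j) (y (j + 1))) +
    a n • v (θ n) (y n)) (a n • v (θ n) (y n))
  rw [add_sub_cancel_right] at h3
  linarith

end IsAveragingModel

/-! ### The martingale part of the averaging error -/

/-- The martingale difference `M_{n+1} + v_{θ_n}(Y_{n+1}) - Π_{θ_n} v_{θ_n}(Y_n)`, set to zero when
`θ_n` is outside the ball of radius `R`. -/
noncomputable def truncatedNoise {d k : ℕ} {Ω : Type*}
    (f : EuclideanSpace ℝ (Fin d) → EuclideanSpace ℝ (Fin k) → EuclideanSpace ℝ (Fin d))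
    (Γ : EuclideanSpace ℝ (Fin d) → Measure (EuclideanSpace ℝ (Fin k)))
    (v : EuclideanSpace ℝ (Fin d) → EuclideanSpace ℝ (Fin k) → EuclideanSpace ℝ (Fin d))
    (R : ℝ) (θ : ℕ → Ω → EuclideanSpace ℝ (Fin d)) (Y : ℕ → Ω → EuclideanSpace ℝ (Fin k))
    (M : ℕ → Ω → EuclideanSpace ℝ (Fin d)) (n : ℕ) : Ω → EuclideanSpace ℝ (Fin d) :=
  {ω | ‖θ n ω‖ ≤ R}.indicator fun ω => M (n + 1) ω + (v (θ n ω) (Y (n + 1) ω) -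
    (v (θ n ω) (Y n ω) - (f (θ n ω) (Y n ω) - meanField f Γ (θ n ω))))

/-- The filtration `ℱ (m + ·)`. -/
def MeasureTheory.Filtration.shift {Ω : Type*} {mΩ : MeasurableSpace Ω} (ℱ : Filtration ℕ mΩ)
    (m : ℕ) : Filtration ℕ mΩ where
  seq n := ℱ (m + n)
  mono' _ _ h := ℱ.mono (Nat.add_le_add_left h m)
  le' _ := ℱ.le _

namespace IsStochasticApproximation

variable {d k : ℕ}
  {f : EuclideanSpace ℝ (Fin d) → EuclideanSpace ℝ (Fin k) → EuclideanSpace ℝ (Fin d)}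
  {Q : EuclideanSpace ℝ (Fin d) → Kernel (EuclideanSpace ℝ (Fin k)) (EuclideanSpace ℝ (Fin k))}
  {Γ : EuclideanSpace ℝ (Fin d) → Measure (EuclideanSpace ℝ (Fin k))}
  {v : EuclideanSpace ℝ (Fin d) → EuclideanSpace ℝ (Fin k) → EuclideanSpace ℝ (Fin d)}
  {K : ℝ} {L : ℝ≥0} {C : ℝ → ℝ} {a : ℕ → ℝ} {K' Cbar : ℝ} {n₁ : ℕ}
  {Ω : Type*} {mΩ : MeasurableSpace Ω} {P : Measure Ω} {ℱ : Filtration ℕ mΩ}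
  {θ : ℕ → Ω → EuclideanSpace ℝ (Fin d)} {Y : ℕ → Ω → EuclideanSpace ℝ (Fin k)}
  {M : ℕ → Ω → EuclideanSpace ℝ (Fin d)} {R : ℝ} {n : ℕ}

theorem measurableSet_norm_le (hsa : IsStochasticApproximation f Q a K' Cbar n₁ P ℱ θ Y M)
    (R : ℝ) (n : ℕ) : MeasurableSet[ℱ n] {ω | ‖θ n ω‖ ≤ R} :=
  (measurable_norm.comp (hsa.measurable_θ n)) measurableSet_Iic

theorem measurable_poisson (hmodel : IsAveragingModel f Q Γ v K L C)
    (hsa : IsStochasticApproximation f Q a K' Cbar n₁ P ℱ θ Y M) (n : ℕ) :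
    Measurable[ℱ n] fun ω =>
      v (θ n ω) (Y n ω) - (f (θ n ω) (Y n ω) - meanField f Γ (θ n ω)) := by
  have h1 : Measurable[ℱ n] fun ω => (θ n ω, Y n ω) :=
    (hsa.measurable_θ n).prodMk (hsa.measurable_Y n)
  exact (hmodel.measurable_uncurry_v.comp h1).sub ((hmodel.measurable_f.comp h1).sub
    (hmodel.lipschitz.continuous.measurable.comp (hsa.measurable_θ n)))

theorem measurable_v_succ (hmodel : IsAveragingModel f Q Γ v K L C)
    (hsa : IsStochasticApproximation f Q a K' Cbar n₁ P ℱ θ Y M) (n : ℕ) :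
    Measurable[ℱ (n + 1)] fun ω => v (θ n ω) (Y (n + 1) ω) :=
  hmodel.measurable_uncurry_v.comp
    (((hsa.measurable_θ n).mono (ℱ.mono n.le_succ) le_rfl).prodMk (hsa.measurable_Y (n + 1)))

theorem integrable_indicator_v (hmodel : IsAveragingModel f Q Γ v K L C)
    (hsa : IsStochasticApproximation f Q a K' Cbar n₁ P ℱ θ Y M) [IsProbabilityMeasure P]
    (hR : 0 < R) (hn : n₁ ≤ n) :
    Integrable ({ω | ‖θ n ω‖ ≤ R}.indicator fun ω => v (θ n ω) (Y (n + 1) ω)) P := by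
  refine .of_bound (C := |C R| * (1 + |Cbar|)) (((hsa.measurable_v_succ hmodel n).mono (ℱ.le _)
    le_rfl).indicator (ℱ.le n _ (hsa.measurableSet_norm_le R n))).aestronglyMeasurable ?_
  filter_upwards [hsa.bounded_Y (n + 1) (by omega)] with ω hω
  by_cases h : ω ∈ {ω | ‖θ n ω‖ ≤ R}
  · rw [Set.indicator_of_mem h]
    exact hmodel.norm_v_le hR h hω
  · rw [Set.indicator_of_notMem h, norm_zero]
    positivity

/-- Freeze `θ_n`: with `X = id` into `(Ω, ℱ n)`, the Markov property makes the conditional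
expectation an integral against `Q (θ n ω) (Y n ω)`. The Poisson equation evaluates it in a form
that is measurable although `Q` need not be so in `θ`. The indicator supplies integrability. -/
theorem condExp_indicator_v (hmodel : IsAveragingModel f Q Γ v K L C)
    (hsa : IsStochasticApproximation f Q a K' Cbar n₁ P ℱ θ Y M) [IsProbabilityMeasure P]
    (hR : 0 < R) (hn : n₁ ≤ n) :
    P[{ω | ‖θ n ω‖ ≤ R}.indicator fun ω => v (θ n ω) (Y (n + 1) ω) | ℱ n] =ᵐ[P]
      {ω | ‖θ n ω‖ ≤ R}.indicator fun ω =>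
        v (θ n ω) (Y n ω) - (f (θ n ω) (Y n ω) - meanField f Γ (θ n ω)) := by
  set A := {ω | ‖θ n ω‖ ≤ R} with hA
  have hAm : MeasurableSet[ℱ n] A := hsa.measurableSet_norm_le R n
  have hF : @Measurable (Ω × EuclideanSpace ℝ (Fin k)) _ (@Prod.instMeasurableSpace _ _ (ℱ n) _) _
      ((A ×ˢ Set.univ).indicator fun p => v (θ n p.1) p.2) := by
    refine Measurable.indicator ?_ (hAm.prod MeasurableSet.univ)
    exact hmodel.measurable_uncurry_v.comp
      (((hsa.measurable_θ n).comp (@measurable_fst _ _ (ℱ n) _)).prodMk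
        (@measurable_snd _ _ (ℱ n) _))
  have hprob : ∀ ω, IsProbabilityMeasure (Q (θ n ω) (Y n ω)) := fun ω => by
    have := hmodel.markov (θ n ω)
    infer_instance
  have hind : ∀ ω z, (A ×ˢ Set.univ).indicator
      (fun p : Ω × EuclideanSpace ℝ (Fin k) => v (θ n p.1) p.2) (ω, z) =
      A.indicator (fun ω => v (θ n ω) z) ω := by
    intro ω z
    by_cases h : ω ∈ A <;> simp [h]
  have hind' : ∀ ω, A.indicator (fun ω => v (θ n ω) (Y (n + 1) ω)) ω =
      A.indicator (fun ω' => v (θ n ω') (Y (n + 1) ω)) ω := by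
    intro ω
    by_cases h : ω ∈ A <;> simp [h]
  have hint := hsa.integrable_indicator_v hmodel hR hn
  have key := condExp_prodMk_ae_eq_integral (mβ := ℱ n) (X := id) (P := P)
    (measurable_id'' (ℱ.le n)) ((hsa.measurable_Y (n + 1)).mono (ℱ.le _) le_rfl)
    (κ := fun ω => Q (θ n ω) (Y n ω)) hprob
    (by simpa only [MeasurableSpace.comap_id] using hsa.markov n) hF.stronglyMeasurable
    (by
      refine hint.congr (Eventually.of_forall fun ω => ?_)
      exact (hind' ω).trans (hind _ _).symm)
  rw [MeasurableSpace.comap_id] at key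
  have hfun : (A.indicator fun ω => v (θ n ω) (Y (n + 1) ω)) = fun ω => (A ×ˢ Set.univ).indicator
      (fun p : Ω × EuclideanSpace ℝ (Fin k) => v (θ n p.1) p.2) (id ω, Y (n + 1) ω) :=
    funext fun ω => (hind' ω).trans (hind _ _).symm
  rw [hfun]
  refine key.trans (Eventually.of_forall fun ω => ?_)
  dsimp only [id]
  simp only [hind]
  by_cases h : ω ∈ A
  · simp only [Set.indicator_of_mem h]
    rw [← hmodel.poisson, sub_sub_cancel]
  · simp [h]

theorem stronglyMeasurable_truncatedNoise (hmodel : IsAveragingModel f Q Γ v K L C)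
    (hsa : IsStochasticApproximation f Q a K' Cbar n₁ P ℱ θ Y M) (R : ℝ) (n : ℕ) :
    StronglyMeasurable[ℱ (n + 1)] (truncatedNoise f Γ v R θ Y M n) := by
  have h1 : Measurable[ℱ (n + 1)] fun ω => M (n + 1) ω + (v (θ n ω) (Y (n + 1) ω) -
      (v (θ n ω) (Y n ω) - (f (θ n ω) (Y n ω) - meanField f Γ (θ n ω)))) :=
    (hsa.measurable_M n).add ((hsa.measurable_v_succ hmodel n).sub
      ((hsa.measurable_poisson hmodel n).mono (ℱ.mono n.le_succ) le_rfl))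
  exact (h1.indicator (ℱ.mono n.le_succ _ (hsa.measurableSet_norm_le R n))).stronglyMeasurable

theorem norm_truncatedNoise_le (hmodel : IsAveragingModel f Q Γ v K L C)
    (hsa : IsStochasticApproximation f Q a K' Cbar n₁ P ℱ θ Y M) (hR : 0 < R) (hn : n₁ ≤ n) :
    ∀ᵐ ω ∂P, ‖truncatedNoise f Γ v R θ Y M n ω‖ ≤
      |K'| * (1 + R) + 2 * (|C R| * (1 + |Cbar|)) + 2 * (K * (1 + R)) := by
  have hK := hmodel.K_nonneg
  filter_upwards [hsa.bounded_Y n hn, hsa.bounded_Y (n + 1) (by omega), hsa.growth_M n]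
    with ω h1 h2 h3
  by_cases h : ω ∈ {ω | ‖θ n ω‖ ≤ R}
  · have h' : ‖θ n ω‖ ≤ R := h
    rw [truncatedNoise, Set.indicator_of_mem h]
    have e1 : ‖M (n + 1) ω‖ ≤ |K'| * (1 + R) := h3.trans (by gcongr; exact le_abs_self _)
    have e2 := hmodel.norm_v_le hR h' h2
    have e3 := hmodel.norm_v_le hR h' h1
    have e4 : ‖f (θ n ω) (Y n ω)‖ ≤ K * (1 + R) := (hmodel.growth _ _).trans (by gcongr)
    have e5 : ‖meanField f Γ (θ n ω)‖ ≤ K * (1 + R) :=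
      (hmodel.norm_meanField_le _).trans (by gcongr)
    have e6 := norm_add_le (M (n + 1) ω) (v (θ n ω) (Y (n + 1) ω) -
      (v (θ n ω) (Y n ω) - (f (θ n ω) (Y n ω) - meanField f Γ (θ n ω))))
    have e7 := norm_sub_le (v (θ n ω) (Y (n + 1) ω))
      (v (θ n ω) (Y n ω) - (f (θ n ω) (Y n ω) - meanField f Γ (θ n ω)))
    have e8 := norm_sub_le (v (θ n ω) (Y n ω)) (f (θ n ω) (Y n ω) - meanField f Γ (θ n ω))
    have e9 := norm_sub_le (f (θ n ω) (Y n ω)) (meanField f Γ (θ n ω))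
    linarith
  · rw [truncatedNoise, Set.indicator_of_notMem h, norm_zero]
    positivity

theorem condExp_truncatedNoise (hmodel : IsAveragingModel f Q Γ v K L C)
    (hsa : IsStochasticApproximation f Q a K' Cbar n₁ P ℱ θ Y M) [IsProbabilityMeasure P]
    (hR : 0 < R) (hn : n₁ ≤ n) : P[truncatedNoise f Γ v R θ Y M n | ℱ n] =ᵐ[P] 0 := by
  set A := {ω | ‖θ n ω‖ ≤ R} with hA
  have hAm : MeasurableSet[ℱ n] A := hsa.measurableSet_norm_le R n
  set w := A.indicator fun ω =>
    v (θ n ω) (Y n ω) - (f (θ n ω) (Y n ω) - meanField f Γ (θ n ω)) with hw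
  have hwm : StronglyMeasurable[ℱ n] w :=
    ((hsa.measurable_poisson hmodel n).indicator hAm).stronglyMeasurable
  have hv := hsa.integrable_indicator_v hmodel hR hn
  have hcv := hsa.condExp_indicator_v hmodel hR hn
  have hwint : Integrable w P := integrable_condExp.congr hcv
  have hMint : Integrable (A.indicator (M (n + 1))) P :=
    (hsa.integrable_M n).indicator (ℱ.le n _ hAm)
  have hdec : truncatedNoise f Γ v R θ Y M n = A.indicator (M (n + 1)) +
      ((A.indicator fun ω => v (θ n ω) (Y (n + 1) ω)) - w) := by
    ext1 ω
    by_cases h : ω ∈ A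
    · simp only [truncatedNoise, ← hA, hw, Pi.add_apply, Pi.sub_apply, Set.indicator_of_mem h]
    · simp only [truncatedNoise, ← hA, hw, Pi.add_apply, Pi.sub_apply, Set.indicator_of_notMem h,
        sub_zero, add_zero]
  rw [hdec]
  filter_upwards [condExp_add hMint (hv.sub hwint) (ℱ n), condExp_sub hv hwint (ℱ n), hcv,
    condExp_indicator (hsa.integrable_M n) hAm, hsa.condExp_M n] with ω h1 h2 h3 h4 h5
  rw [h1, Pi.add_apply, h2, Pi.sub_apply, h3, h4, condExp_of_stronglyMeasurable (ℱ.le n) hwm hwint]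
  by_cases h : ω ∈ A
  · rw [Set.indicator_of_mem h, h5, hw, sub_self]
    simp
  · rw [Set.indicator_of_notMem h, hw, sub_self, add_zero]
    rfl

/-- Under the conditional law given an event of `ℱ n₀`, the truncated noise is a bounded martingale
difference sequence. -/
theorem isBoundedMartingaleDifference (hmodel : IsAveragingModel f Q Γ v K L C)
    (hsa : IsStochasticApproximation f Q a K' Cbar n₁ P ℱ θ Y M) [IsProbabilityMeasure P]
    (ha : ∀ n, 0 ≤ a n) (hR : 0 < R) {n₀ : ℕ} (hn₀ : n₁ ≤ n₀) {s : Set Ω}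
    (hs : MeasurableSet[ℱ n₀] s) (hs0 : P s ≠ 0) :
    IsBoundedMartingaleDifference (P[|s]) (ℱ.shift n₀)
      (fun i ω => a (n₀ + i) • truncatedNoise f Γ v R θ Y M (n₀ + i) ω)
      (fun i => a (n₀ + i) *
        (|K'| * (1 + R) + 2 * (|C R| * (1 + |Cbar|)) + 2 * (K * (1 + R)))) where
  stronglyMeasurable i :=
    (hsa.stronglyMeasurable_truncatedNoise hmodel R (n₀ + i)).const_smul (a (n₀ + i))
  norm_le i := by
    filter_upwards [cond_absolutelyContinuous.ae_le
      (hsa.norm_truncatedNoise_le hmodel hR (show n₁ ≤ n₀ + i by omega))] with ω hω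
    rw [norm_smul, Real.norm_of_nonneg (ha _)]
    exact mul_le_mul_of_nonneg_left hω (ha _)
  condExp_eq_zero i := by
    have hn : n₁ ≤ n₀ + i := by omega
    have hint : Integrable (truncatedNoise f Γ v R θ Y M (n₀ + i)) P :=
      .of_bound ((hsa.stronglyMeasurable_truncatedNoise hmodel R (n₀ + i)).mono
        (ℱ.le _)).aestronglyMeasurable _ (hsa.norm_truncatedNoise_le hmodel hR hn)
    refine condExp_cond_ae_eq_zero (ℱ.le _) (ℱ.mono (Nat.le_add_right _ _) _ hs) hs0
      (hint.smul (a (n₀ + i))) ?_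
    filter_upwards [condExp_smul (μ := P) (a (n₀ + i)) (truncatedNoise f Γ v R θ Y M (n₀ + i))
      (ℱ (n₀ + i)), hsa.condExp_truncatedNoise hmodel hR hn] with ω h1 h2
    have h3 : (P[fun ω => a (n₀ + i) • truncatedNoise f Γ v R θ Y M (n₀ + i) ω | ℱ (n₀ + i)]) ω =
        (a (n₀ + i) • P[truncatedNoise f Γ v R θ Y M (n₀ + i) | ℱ (n₀ + i)]) ω := h1
    exact h3.trans (by rw [Pi.smul_apply, h2]; simp)

end IsStochasticApproximation

/-! ### Lock-in along a path -/

/-- This lets bounds, or the Cauchy property, for noise sums started at `n₀` control every later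
window. -/
theorem norm_sum_Ico_eq_dist_sum_range {E : Type*} [NormedAddCommGroup E] {g : ℕ → E}
    {n₀ m j : ℕ} (hm : n₀ ≤ m) (hmj : m ≤ j) :
    ‖∑ i ∈ Finset.Ico m j, g i‖ = dist (∑ i ∈ Finset.range (j - n₀), g (n₀ + i))
      (∑ i ∈ Finset.range (m - n₀), g (n₀ + i)) := by
  rw [dist_eq_norm, ← Finset.sum_Ico_eq_sum_range, ← Finset.sum_Ico_eq_sum_range,
    ← Finset.sum_Ico_consecutive g hm hmj, add_sub_cancel_left]

namespace IsAveragingModel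

variable {d k : ℕ}
  {f : EuclideanSpace ℝ (Fin d) → EuclideanSpace ℝ (Fin k) → EuclideanSpace ℝ (Fin d)}
  {Q : EuclideanSpace ℝ (Fin d) → Kernel (EuclideanSpace ℝ (Fin k)) (EuclideanSpace ℝ (Fin k))}
  {Γ : EuclideanSpace ℝ (Fin d) → Measure (EuclideanSpace ℝ (Fin k))}
  {v : EuclideanSpace ℝ (Fin d) → EuclideanSpace ℝ (Fin k) → EuclideanSpace ℝ (Fin d)}
  {K : ℝ} {L : ℝ≥0} {C : ℝ → ℝ}
  {a : ℕ → ℝ} {x : ℕ → EuclideanSpace ℝ (Fin d)} {y : ℕ → EuclideanSpace ℝ (Fin k)}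
  {z ξ : ℕ → EuclideanSpace ℝ (Fin d)} {n₀ : ℕ} {K' Cbar R : ℝ}

theorem norm_step_le (hmodel : IsAveragingModel f Q Γ v K L C) (ha : IsStepSize a)
    (hx : ∀ n, x (n + 1) = x n + a n • (f (x n) (y n) + z n))
    (hz : ∀ n, ‖z n‖ ≤ K' * (1 + ‖x n‖)) {n : ℕ} (hn : ‖x n‖ ≤ R) :
    ‖x (n + 1) - x n‖ ≤ a n * ((K + |K'|) * (1 + R)) := by
  rw [hx, add_sub_cancel_left, norm_smul, Real.norm_of_nonneg (ha.pos n).le]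
  refine mul_le_mul_of_nonneg_left ?_ (ha.pos n).le
  have hK := hmodel.K_nonneg
  calc ‖f (x n) (y n) + z n‖ ≤ K * (1 + ‖x n‖) + K' * (1 + ‖x n‖) :=
        (norm_add_le _ _).trans (add_le_add (hmodel.growth _ _) (hz n))
    _ = (K + K') * (1 + ‖x n‖) := by ring
    _ ≤ (K + |K'|) * (1 + R) := by gcongr; exact le_abs_self _

/-- The accumulated averaging and noise errors are controlled by the martingale part. -/
theorem norm_sum_error_le (hmodel : IsAveragingModel f Q Γ v K L C) (ha : IsStepSize a)
    (ha1 : ∀ n, n₀ ≤ n → a n ≤ 1) (hx : ∀ n, x (n + 1) = x n + a n • (f (x n) (y n) + z n))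
    (hy : ∀ n, n₀ ≤ n → ‖y n‖ ≤ Cbar) (hz : ∀ n, ‖z n‖ ≤ K' * (1 + ‖x n‖))
    (hξ : ∀ n, ‖x n‖ ≤ R → ξ n = z n + (v (x n) (y (n + 1)) -
      (v (x n) (y n) - (f (x n) (y n) - meanField f Γ (x n))))) (hR : 0 < R)
    {m j : ℕ} (hm : n₀ ≤ m) (hmj : m ≤ j) (hball : ∀ i, n₀ ≤ i → i < j → ‖x i‖ ≤ R) :
    ‖∑ i ∈ Finset.Ico m j, a i • (f (x i) (y i) + z i - meanField f Γ (x i))‖ ≤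
      ‖∑ i ∈ Finset.Ico m j, a i • ξ i‖ +
        |C (R + (K + |K'|) * (1 + R))| * (1 + |Cbar|) *
          (2 * a m + (K + |K'|) * (1 + R) * tailSq a m) := by
  have hK := hmodel.K_nonneg
  set β := (K + |K'|) * (1 + R) with hβ
  have hβ0 : 0 ≤ β := by positivity
  have hstep : ∀ i, n₀ ≤ i → i < j → ‖x (i + 1) - x i‖ ≤ a i * β := fun i hi hij =>
    hmodel.norm_step_le ha hx hz (hball i hi hij)
  rcases hmj.eq_or_lt with rfl | hlt
  · have h1 := (ha.pos m).le
    have h2 := (ha.tailSq_pos m).le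
    simp only [Finset.Ico_self, Finset.sum_empty, norm_zero, zero_add]
    positivity
  -- The endpoint `x j` may have just left the ball, but by at most one step, of length at most `β`
  -- since `a p ≤ 1`. This is why `C` is evaluated at `R + β`.
  have hball' : ∀ i, m ≤ i → i ≤ j → ‖x i‖ ≤ R + β := by
    intro i hi hij
    rcases hij.lt_or_eq with h | rfl
    · linarith [hball i (hm.trans hi) h]
    · obtain ⟨p, rfl⟩ : ∃ p, i = p + 1 := ⟨i - 1, by omega⟩
      have hp : n₀ ≤ p := by omega
      have h1 := hstep p hp p.lt_succ_self
      have h2 := hball p hp p.lt_succ_self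
      have h3 := norm_add_le (x p) (x (p + 1) - x p)
      rw [add_sub_cancel] at h3
      have h4 : a p * β ≤ 1 * β := mul_le_mul_of_nonneg_right (ha1 p hp) hβ0
      linarith
  have hrem := hmodel.norm_sum_v_sub_le (c := Cbar) (show 0 < R + β by linarith)
    (fun n => (ha.pos n).le) ha.antitone hmj hball' (fun i hi => hy i (hm.trans hi))
    (fun i hi hij => hstep i (hm.trans hi) hij)
  have hsum : ∑ i ∈ Finset.Ico m j, a i • (f (x i) (y i) + z i - meanField f Γ (x i)) =
      ∑ i ∈ Finset.Ico m j, a i • ξ i +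
        ∑ i ∈ Finset.Ico m j, a i • (v (x i) (y i) - v (x i) (y (i + 1))) := by
    rw [← Finset.sum_add_distrib]
    refine Finset.sum_congr rfl fun i hi => ?_
    rw [Finset.mem_Ico] at hi
    rw [← smul_add, hξ i (hball i (hm.trans hi.1) hi.2)]
    congr 1
    abel
  rw [hsum]
  refine (norm_add_le _ _).trans (add_le_add le_rfl (hrem.trans ?_))
  gcongr
  exact ha.sum_Ico_le_tailSq le_rfl

/-- If the martingale part of the noise converges and stays small, then the path is locked into `S`
and converges to the attractor. -/
theorem tendsto_infDist_interpolate_of_noise_le (hmodel : IsAveragingModel f Q Γ v K L C)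
    (ha : IsStepSize a)
    (ha1 : ∀ n, n₀ ≤ n → a n ≤ 1) (hx : ∀ n, x (n + 1) = x n + a n • (f (x n) (y n) + z n))
    (hy : ∀ n, n₀ ≤ n → ‖y n‖ ≤ Cbar) (hz : ∀ n, ‖z n‖ ≤ K' * (1 + ‖x n‖))
    (hξ : ∀ n, ‖x n‖ ≤ R → ξ n = z n + (v (x n) (y (n + 1)) -
      (v (x n) (y n) - (f (x n) (y n) - meanField f Γ (x n))))) (hR : 0 < R)
    {S A H : Set (EuclideanSpace ℝ (Fin d))} (hH : H.Nonempty) {T R₀ b δ η : ℝ} (hT : 0 ≤ T)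
    (hflow : ∀ p ∈ S, ∃ φ, φ 0 = p ∧ IsODESolution (meanField f Γ) φ ∧
      (∀ t, 0 ≤ t → ‖φ t‖ ≤ R₀) ∧
      (∀ t, 0 ≤ t → ‖meanField f Γ (φ t)‖ ≤ b) ∧ ∀ t, T ≤ t → φ t ∈ A)
    (hattr : ∀ ε, 0 < ε → ∃ T', ∀ p ∈ S, ∃ φ, φ 0 = p ∧ IsODESolution (meanField f Γ) φ ∧
      (∀ t, 0 ≤ t → ‖meanField f Γ (φ t)‖ ≤ b) ∧
      ∀ t, 0 ≤ t → T' ≤ t → φ t ∈ Metric.thickening ε H)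
    (hδ : 0 ≤ δ) (hAS : Metric.thickening δ A ⊆ S) (hRδ : R₀ + δ ≤ R)
    (hnoise : ∀ n, ‖∑ i ∈ Finset.range n, a (n₀ + i) • ξ (n₀ + i)‖ ≤ η)
    (hcauchy : CauchySeq fun n => ∑ i ∈ Finset.range n, a (n₀ + i) • ξ (n₀ + i))
    (hsmall : Real.exp (L * (T + 1)) * (2 * η + |C (R + (K + |K'|) * (1 + R))| * (1 + |Cbar|) *
      (2 * a n₀ + (K + |K'|) * (1 + R) * tailSq a n₀) + L * b * tailSq a n₀) < δ)
    (h0 : x n₀ ∈ S) :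
    Tendsto (fun t => Metric.infDist (interpolate a x t) H) atTop (𝓝 0) := by
  have hK := hmodel.K_nonneg
  set U := |C (R + (K + |K'|) * (1 + R))| * (1 + |Cbar|) with hU
  have hU0 : 0 ≤ U := by positivity
  have hb0 : 0 ≤ b := by
    obtain ⟨φ, -, -, -, hφb, -⟩ := hflow _ h0
    exact (norm_nonneg _).trans (hφb 0 le_rfl)
  set e : ℕ → EuclideanSpace ℝ (Fin d) :=
    fun n => a n • (f (x n) (y n) + z n - meanField f Γ (x n)) with he
  have hxe : ∀ n, x (n + 1) = x n + a n • meanField f Γ (x n) + e n := by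
    intro n
    rw [hx, he]
    simp only [smul_sub, smul_add]
    abel
  have herr : ∀ {m j : ℕ}, n₀ ≤ m → m ≤ j → (∀ i, n₀ ≤ i → i < j → ‖x i‖ ≤ R) →
      ‖∑ i ∈ Finset.Ico m j, e i‖ ≤ _ := fun hm hmj hball =>
    hmodel.norm_sum_error_le ha ha1 hx hy hz hξ hR hm hmj hball
  have htail : ∀ m, n₀ ≤ m → tailSq a m ≤ tailSq a n₀ := by
    intro m hm
    refine (ha.summable_tail m).tsum_le_of_sum_range_le fun n => ?_
    have := ha.sum_Ico_le_tailSq (j := m + n) hm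
    rwa [Finset.sum_Ico_eq_sum_range, Nat.add_sub_cancel_left] at this
  have hlock := fun n hn => exists_mem_of_perturbed_euler (n := n) hmodel.lipschitz
    (fun n => (ha.pos n).le) hxe hT hflow hδ hAS hRδ ha1
    (η := 2 * η + U * (2 * a n₀ + (K + |K'|) * (1 + R) * tailSq a n₀)) (σ := tailSq a n₀)
    (fun n hn hball m j hm hmj hjn => by
      refine (herr hm hmj fun i hi hij => hball i hi (by omega)).trans ?_
      have h1 := norm_sum_Ico_eq_dist_sum_range (g := fun i => a i • ξ i) hm hmj
      have h2 := dist_le_norm_add_norm (∑ i ∈ Finset.range (j - n₀), a (n₀ + i) • ξ (n₀ + i))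
        (∑ i ∈ Finset.range (m - n₀), a (n₀ + i) • ξ (n₀ + i))
      have h3 := hnoise (j - n₀)
      have h4 := hnoise (m - n₀)
      have h5 := ha.antitone hm
      have h6 := htail m hm
      refine add_le_add (by linarith) ?_
      gcongr)
    (fun m j hm => ha.sum_Ico_le_tailSq hm) hsmall h0 hn
  -- The path is now known to stay in the ball for all time, so the error bound is unconditional,
  -- and it tends to zero by the Cauchy property.
  have hconv := tendsto_infDist_of_perturbed_euler hmodel.lipschitz ha hxe hattr hH hb0
    (n₀ := n₀) (T := T + 1) (fun n hn => (hlock n hn).2) (fun η' hη' => by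
      obtain ⟨N, hN⟩ := Metric.cauchySeq_iff.1 hcauchy (η' / 2) (half_pos hη')
      have hlim : Tendsto (fun m => U * (2 * a m + (K + |K'|) * (1 + R) * tailSq a m)) atTop
          (𝓝 0) := by
        simpa using ((ha.tendsto_zero.const_mul 2).add
          ((tendsto_tailSq a).const_mul ((K + |K'|) * (1 + R)))).const_mul U
      obtain ⟨N', hN'⟩ := eventually_atTop.1 (hlim.eventually (gt_mem_nhds (half_pos hη')))
      refine ⟨n₀ + N + N', fun m j hm hmj => ?_⟩
      refine (herr (by omega) hmj fun i hi _ => (hlock i hi).1).trans ?_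
      have h1 := norm_sum_Ico_eq_dist_sum_range (n₀ := n₀) (g := fun i => a i • ξ i)
        (show n₀ ≤ m by omega) hmj
      have h2 := hN (j - n₀) (by omega) (m - n₀) (by omega)
      have h3 := hN' m (by omega)
      linarith)
  refine ha.tendsto_infDist_interpolate hconv ?_
  have hlim : Tendsto (fun n => a n * ((K + |K'|) * (1 + R))) atTop (𝓝 0) := by
    simpa using ha.tendsto_zero.mul_const ((K + |K'|) * (1 + R))
  refine squeeze_zero' (Eventually.of_forall fun _ => norm_nonneg _) ?_ hlim
  filter_upwards [eventually_ge_atTop n₀] with n hn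
  exact hmodel.norm_step_le ha hx hz (hlock n hn).1

end IsAveragingModel

/-! ### The lock-in probability -/

/-- Bounds `δ` by the size of `B` alone, so that the truncation radius, and with it the constant in
the exponent, can be fixed before `δ`. Positive dimension provides a direction in which to move by
`δ / 2`. -/
theorem le_of_thickening_subset_closedBall {d : ℕ} (hd : 0 < d)
    {A : Set (EuclideanSpace ℝ (Fin d))} (hA : A.Nonempty) {δ r : ℝ} (hδ : 0 < δ)
    (hsub : Metric.thickening δ A ⊆ Metric.closedBall 0 r) : δ ≤ 4 * r := by
  obtain ⟨x, hx⟩ := hA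
  set u : EuclideanSpace ℝ (Fin d) := EuclideanSpace.single ⟨0, hd⟩ (δ / 2) with hu
  have hun : ‖u‖ = δ / 2 := by
    rw [hu, EuclideanSpace.single, PiLp.norm_single, Real.norm_of_nonneg (by linarith)]
  have h1 := hsub (Metric.self_subset_thickening hδ A hx)
  have h2 : x + u ∈ Metric.closedBall 0 r := by
    refine hsub (Metric.mem_thickening_iff.2 ⟨x, hx, ?_⟩)
    rw [dist_eq_norm, add_sub_cancel_left, hun]
    linarith
  rw [mem_closedBall_zero_iff] at h1 h2
  have h3 := norm_sub_le (x + u) x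
  rw [add_sub_cancel_left, hun] at h3
  linarith

/-- On the event that the martingale part of the noise stays small, almost every path converges. -/
theorem ae_mem_or_tendsto {d k : ℕ}
    {f : EuclideanSpace ℝ (Fin d) → EuclideanSpace ℝ (Fin k) → EuclideanSpace ℝ (Fin d)}
    {Q : EuclideanSpace ℝ (Fin d) → Kernel (EuclideanSpace ℝ (Fin k)) (EuclideanSpace ℝ (Fin k))}
    {Γ : EuclideanSpace ℝ (Fin d) → Measure (EuclideanSpace ℝ (Fin k))}
    {v : EuclideanSpace ℝ (Fin d) → EuclideanSpace ℝ (Fin k) → EuclideanSpace ℝ (Fin d)}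
    {K : ℝ} {L : ℝ≥0} {C : ℝ → ℝ} (hmodel : IsAveragingModel f Q Γ v K L C)
    {a : ℕ → ℝ} (ha : IsStepSize a) {n₀ n₁ : ℕ} (hn₀ : n₁ ≤ n₀) (ha1 : ∀ n, n₀ ≤ n → a n ≤ 1)
    {B A H : Set (EuclideanSpace ℝ (Fin d))} (hB : IsOpen B) (hH : H.Nonempty)
    {K' Cbar R T R₀ b δ η : ℝ} (hR : 0 < R) (hT : 0 ≤ T)
    (hflow : ∀ p ∈ B, ∃ φ, φ 0 = p ∧ IsODESolution (meanField f Γ) φ ∧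
      (∀ t, 0 ≤ t → ‖φ t‖ ≤ R₀) ∧
      (∀ t, 0 ≤ t → ‖meanField f Γ (φ t)‖ ≤ b) ∧ ∀ t, T ≤ t → φ t ∈ A)
    (hattr : ∀ ε, 0 < ε → ∃ T', ∀ p ∈ B, ∃ φ, φ 0 = p ∧ IsODESolution (meanField f Γ) φ ∧
      (∀ t, 0 ≤ t → ‖meanField f Γ (φ t)‖ ≤ b) ∧
      ∀ t, 0 ≤ t → T' ≤ t → φ t ∈ Metric.thickening ε H)
    (hδ : 0 ≤ δ) (hAB : Metric.thickening δ A ⊆ B) (hRδ : R₀ + δ ≤ R)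
    (hsmall : Real.exp (L * (T + 1)) * (2 * η + |C (R + (K + |K'|) * (1 + R))| * (1 + |Cbar|) *
      (2 * a n₀ + (K + |K'|) * (1 + R) * tailSq a n₀) + L * b * tailSq a n₀) < δ)
    {Ω : Type*} {mΩ : MeasurableSpace Ω} {P : Measure Ω} [IsProbabilityMeasure P]
    {ℱ : Filtration ℕ mΩ} {θ : ℕ → Ω → EuclideanSpace ℝ (Fin d)}
    {Y : ℕ → Ω → EuclideanSpace ℝ (Fin k)} {M : ℕ → Ω → EuclideanSpace ℝ (Fin d)}
    (hsa : IsStochasticApproximation f Q a K' Cbar n₁ P ℱ θ Y M)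
    (hcauchy : ∀ᵐ ω ∂(P[|{ω | θ n₀ ω ∈ B}]), CauchySeq fun n =>
      ∑ i ∈ Finset.range n, a (n₀ + i) • truncatedNoise f Γ v R θ Y M (n₀ + i) ω) :
    ∀ᵐ ω ∂(P[|{ω | θ n₀ ω ∈ B}]),
      (∃ n, η ≤ ‖∑ i ∈ Finset.range n, a (n₀ + i) • truncatedNoise f Γ v R θ Y M (n₀ + i) ω‖) ∨
      Tendsto (fun t : ℝ => Metric.infDist (interpolate a (fun n => θ n ω) t) H) atTop (𝓝 0) := by
  have hBm : MeasurableSet {ω | θ n₀ ω ∈ B} :=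
    ℱ.le n₀ _ (hsa.measurable_θ n₀ hB.measurableSet)
  have hY : ∀ᵐ ω ∂P, ∀ n, n₀ ≤ n → ‖Y n ω‖ ≤ Cbar := by
    refine ae_all_iff.2 fun n => ?_
    by_cases hn : n₀ ≤ n
    · filter_upwards [hsa.bounded_Y n (hn₀.trans hn)] with ω hω _ using hω
    · exact Eventually.of_forall fun ω h => absurd h hn
  filter_upwards [hcauchy, ae_cond_mem hBm, cond_absolutelyContinuous.ae_le hY,
    cond_absolutelyContinuous.ae_le (ae_all_iff.2 hsa.growth_M)] with ω h1 h2 h3 h4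
  by_cases hex : ∃ n, η ≤
      ‖∑ i ∈ Finset.range n, a (n₀ + i) • truncatedNoise f Γ v R θ Y M (n₀ + i) ω‖
  · exact Or.inl hex
  · push Not at hex
    refine Or.inr ?_
    exact hmodel.tendsto_infDist_interpolate_of_noise_le ha ha1
      (x := fun n => θ n ω) (y := fun n => Y n ω) (z := fun n => M (n + 1) ω)
      (ξ := fun n => truncatedNoise f Γ v R θ Y M n ω) (fun n => hsa.recursion n ω) h3 h4
      (fun n hn => Set.indicator_of_mem (s := {ω | ‖θ n ω‖ ≤ R}) hn _) hR hH hT hflow hattr hδ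
      hAB hRδ (fun n => (hex n).le) h1 hsmall h2

theorem mainTheorem1 {d k : ℕ}
    (f : EuclideanSpace ℝ (Fin d) → EuclideanSpace ℝ (Fin k) → EuclideanSpace ℝ (Fin d))
    (Q : EuclideanSpace ℝ (Fin d) →
      Kernel (EuclideanSpace ℝ (Fin k)) (EuclideanSpace ℝ (Fin k)))
    (Γ : EuclideanSpace ℝ (Fin d) → Measure (EuclideanSpace ℝ (Fin k)))
    (v : EuclideanSpace ℝ (Fin d) → EuclideanSpace ℝ (Fin k) → EuclideanSpace ℝ (Fin d))
    (K : ℝ) (L : ℝ≥0) (C : ℝ → ℝ)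
    (hmodel : IsAveragingModel f Q Γ v K L C)
    (G : Set (EuclideanSpace ℝ (Fin d))) (V : EuclideanSpace ℝ (Fin d) → ℝ)
    (H : Set (EuclideanSpace ℝ (Fin d)))
    (hH : IsLyapunovAttractor (meanField f Γ) G V H)
    (B : Set (EuclideanSpace ℝ (Fin d))) (hB : IsOpen B) (hBc : IsCompact (closure B))
    (hHB : H ⊆ B) (hBG : closure B ⊆ G)
    (K' Cbar : ℝ) (ε₁ : ℝ) (hε₁ : 0 < ε₁) :
    -- the constants depend neither on the step sizes, nor on `δ`, `n₀` or the process
    ∃ Khat Chat : ℝ, 0 < Khat ∧ 0 < Chat ∧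
      ∀ (ε δ : ℝ), ε₁ < ε → 0 < δ →
        Metric.thickening δ (Metric.thickening ε₁ H) ⊆ Metric.thickening ε H →
        Metric.thickening ε H ⊆ B →
      ∀ a : ℕ → ℝ, IsStepSize a → ∀ n₁ : ℕ, ∃ N : ℕ, ∀ n₀ : ℕ, N ≤ n₀ →
      ∀ (Ω : Type*) (mΩ : MeasurableSpace Ω) (P : Measure Ω) (_ : IsProbabilityMeasure P)
        (ℱ : Filtration ℕ mΩ)
        (θ : ℕ → Ω → EuclideanSpace ℝ (Fin d)) (Y : ℕ → Ω → EuclideanSpace ℝ (Fin k))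
        (M : ℕ → Ω → EuclideanSpace ℝ (Fin d)),
        IsStochasticApproximation f Q a K' Cbar n₁ P ℱ θ Y M →
        P {ω | θ n₀ ω ∈ B} ≠ 0 →
        1 - 2 * d * Real.exp (-(Khat * δ ^ 2) / (d * tailSq a n₀))
            - 2 * d * Real.exp (-(Chat * δ ^ 2) / (d * tailSq a n₀))
          ≤ (P[|{ω | θ n₀ ω ∈ B}]).real
              {ω | Tendsto
                (fun t : ℝ => Metric.infDist (interpolate a (fun n => θ n ω) t) H)
                atTop (𝓝 0)} := by
  rcases Nat.eq_zero_or_pos d with rfl | hd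
  · refine ⟨1, 1, one_pos, one_pos, fun ε δ _ _ _ _ a _ n₁ => ⟨0, fun n₀ _ Ω mΩ P _ ℱ θ Y M _ hP =>
      ?_⟩⟩
    have := cond_isProbabilityMeasure hP
    obtain ⟨p, hp⟩ := hH.nonempty
    have hconv : ∀ ω, Tendsto
        (fun t : ℝ => Metric.infDist (interpolate a (fun n => θ n ω) t) H) atTop (𝓝 0) := by
      intro ω
      refine tendsto_const_nhds.congr fun t => (Metric.infDist_zero_of_mem ?_).symm
      rwa [Subsingleton.elim (interpolate a (fun n => θ n ω) t) p]
    simp [hconv]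
  have hK := hmodel.K_nonneg
  obtain ⟨r, hr⟩ : ∃ r, B ⊆ Metric.closedBall 0 r :=
    (hBc.isBounded.subset subset_closure).subset_closedBall 0
  have huniform : ∀ ε, 0 < ε → ∃ T R, ∀ p ∈ B, ∃ φ, φ 0 = p ∧ IsODESolution (meanField f Γ) φ ∧
      (∀ t, 0 ≤ t → ‖φ t‖ ≤ R) ∧ ∀ t, 0 ≤ t → T ≤ t → φ t ∈ Metric.thickening ε H := by
    intro ε hε
    obtain ⟨T, R, hTR⟩ := hH.exists_uniform_attraction hmodel.lipschitz hBc hBG hε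
    refine ⟨T, R, fun p hp => ?_⟩
    obtain ⟨φ, hφ0, hφ, -⟩ := hH.attracts (hBG (subset_closure hp))
    have := hTR φ hφ (by rw [hφ0]; exact subset_closure hp)
    exact ⟨φ, hφ0, hφ, this.1, this.2⟩
  obtain ⟨T₁, R₁, hTR⟩ := huniform ε₁ hε₁
  obtain ⟨T, hT0, hT⟩ : ∃ T, 0 ≤ T ∧ T₁ ≤ T := ⟨max 0 T₁, le_max_left _ _, le_max_right _ _⟩
  set b := K * (1 + |R₁|) with hb
  have hfield : ∀ p : EuclideanSpace ℝ (Fin d), ‖p‖ ≤ R₁ → ‖meanField f Γ p‖ ≤ b := by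
    intro p hp
    refine (hmodel.norm_meanField_le p).trans ?_
    rw [hb]
    gcongr
    exact hp.trans (le_abs_self _)
  have hflow : ∀ p ∈ B, ∃ φ, φ 0 = p ∧ IsODESolution (meanField f Γ) φ ∧
      (∀ t, 0 ≤ t → ‖φ t‖ ≤ R₁) ∧ (∀ t, 0 ≤ t → ‖meanField f Γ (φ t)‖ ≤ b) ∧
      ∀ t, T ≤ t → φ t ∈ Metric.thickening ε₁ H := by
    intro p hp
    obtain ⟨φ, hφ0, hφ, hφR, hφT⟩ := hTR p hp
    exact ⟨φ, hφ0, hφ, hφR, fun t ht => hfield _ (hφR t ht),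
      fun t ht => hφT t (hT0.trans ht) (hT.trans ht)⟩
  have hattr : ∀ ε, 0 < ε → ∃ T', ∀ p ∈ B, ∃ φ, φ 0 = p ∧ IsODESolution (meanField f Γ) φ ∧
      (∀ t, 0 ≤ t → ‖meanField f Γ (φ t)‖ ≤ b) ∧
      ∀ t, 0 ≤ t → T' ≤ t → φ t ∈ Metric.thickening ε H := by
    intro ε hε
    obtain ⟨T', R', hTR'⟩ := huniform ε hε
    refine ⟨T', fun p hp => ?_⟩
    obtain ⟨φ, hφ0, hφ, -, hφT⟩ := hTR' p hp
    obtain ⟨ψ, hψ0, hψ, hψR, -⟩ := hTR p hp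
    refine ⟨φ, hφ0, hφ, fun t ht => hfield _ ?_, hφT⟩
    -- By uniqueness the trajectory is the one already bounded by `R₁`, so `b` does not depend on
    -- `ε`.
    have hd := hφ.dist_le hmodel.lipschitz hψ ht
    rw [hφ0, hψ0, dist_self, zero_mul, dist_le_zero] at hd
    rw [hd]
    exact hψR t ht
  -- Large enough for `R₁ + δ ≤ R` for every admissible `δ`, since `δ ≤ 4 * |r|`.
  set R := |R₁| + 4 * |r| + 1 with hR
  have hR0 : 0 < R := by positivity
  set κ := Real.exp (L * (T + 1)) with hκ
  have hκ0 : 0 < κ := Real.exp_pos _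
  set c := |K'| * (1 + R) + 2 * (|C R| * (1 + |Cbar|)) + 2 * (K * (1 + R)) with hc
  have hc0 : 0 ≤ c := by positivity
  -- With `η = δ / (8 κ)` and variance proxy `(c + 1)² s(n₀)`, the exponent `η² / (2 d σ)` has the
  -- factor `1 / (2 · 64)`; `c + 1` instead of `c` avoids a zero denominator. A single exponential
  -- already suffices, so the second constant is arbitrary.
  refine ⟨1 / (128 * κ ^ 2 * (c + 1) ^ 2), 1, by positivity, one_pos, ?_⟩
  intro ε δ _ hδ hεH hεB a ha n₁
  have hAB : Metric.thickening δ (Metric.thickening ε₁ H) ⊆ B := hεH.trans hεB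
  have hδr : δ ≤ 4 * |r| := (le_of_thickening_subset_closedBall hd
    (hH.nonempty.mono (Metric.self_subset_thickening hε₁ H)) hδ (hAB.trans hr)).trans
    (by linarith [le_abs_self r])
  set η := δ / (8 * κ) with hη
  have hη0 : 0 < η := by positivity
  -- The noise contributes `2 η κ = δ / 4` and the rest vanishes, so the tracking error is
  -- eventually below `δ`. The threshold depends on the steps and on `δ`, not on the process.
  have hlim : Tendsto (fun n => κ * (2 * η + |C (R + (K + |K'|) * (1 + R))| * (1 + |Cbar|) *
      (2 * a n + (K + |K'|) * (1 + R) * tailSq a n) + L * b * tailSq a n)) atTop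
      (𝓝 (δ / 4)) := by
    have h1 := ((((ha.tendsto_zero.const_mul 2).add
      ((tendsto_tailSq a).const_mul ((K + |K'|) * (1 + R)))).const_mul
        (|C (R + (K + |K'|) * (1 + R))| * (1 + |Cbar|))).const_add (2 * η)).add
      ((tendsto_tailSq a).const_mul (L * b : ℝ))
    have h2 := h1.const_mul κ
    have h3 : κ * (2 * η) = δ / 4 := by
      rw [hη]
      field_simp
      norm_num
    simpa [h3] using h2
  obtain ⟨N₁, hN₁⟩ := eventually_atTop.1
    (hlim.eventually (gt_mem_nhds (show δ / 4 < δ by linarith)))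
  obtain ⟨N₂, hN₂⟩ := eventually_atTop.1 (ha.tendsto_zero.eventually (ge_mem_nhds one_pos))
  refine ⟨n₁ + N₁ + N₂, fun n₀ hn₀ Ω mΩ P _ ℱ θ Y M hsa hP => ?_⟩
  have := cond_isProbabilityMeasure hP
  have hs := ha.tailSq_pos n₀
  have hD := hsa.isBoundedMartingaleDifference hmodel (fun n => (ha.pos n).le) hR0
    (show n₁ ≤ n₀ by omega) (s := {ω | θ n₀ ω ∈ B}) (hsa.measurable_θ n₀ hB.measurableSet) hP
  have hσ : ∀ n, ∑ i ∈ Finset.range n, (a (n₀ + i) * c) ^ 2 ≤ (c + 1) ^ 2 * tailSq a n₀ := by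
    intro n
    simp only [mul_pow]
    rw [← Finset.sum_mul, mul_comm]
    have h1 := ha.sum_range_le_tailSq n₀ n
    gcongr
    linarith
  have hbad := hD.measure_exists_le_norm (by positivity) hσ hη0
  have hae := ae_mem_or_tendsto hmodel ha (show n₁ ≤ n₀ by omega)
    (fun n hn => hN₂ n (by omega)) hB hH.nonempty hR0 hT0 hflow hattr hδ.le hAB
    (by rw [hR]; linarith [le_abs_self R₁]) (hN₁ n₀ (by omega)) hsa (hD.ae_cauchySeq hσ)
  set μ := P[|{ω | θ n₀ ω ∈ B}] with hμ
  have hexp : -η ^ 2 / (2 * d * ((c + 1) ^ 2 * tailSq a n₀)) =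
      -(1 / (128 * κ ^ 2 * (c + 1) ^ 2) * δ ^ 2) / (d * tailSq a n₀) := by
    have hd' : (0 : ℝ) < d := Nat.cast_pos.2 hd
    rw [hη]
    field_simp
    norm_num
  rw [hexp] at hbad
  set bad := {ω | ∃ n, η ≤
    ‖∑ i ∈ Finset.range n, a (n₀ + i) • truncatedNoise f Γ v R θ Y M (n₀ + i) ω‖}
  set conv := {ω | Tendsto
    (fun t : ℝ => Metric.infDist (interpolate a (fun n => θ n ω) t) H) atTop (𝓝 0)}
  -- Subadditivity holds for arbitrary sets, so measurability of the convergence event is not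
  -- needed.
  have hone : 1 ≤ μ.real bad + μ.real conv := by
    refine le_trans ?_ (measureReal_union_le bad conv)
    have h1 : μ (bad ∪ conv) = 1 :=
      (measure_congr (eventuallyEq_univ.2 hae)).trans measure_univ
    rw [measureReal_def, h1, ENNReal.toReal_one]
  have hbad' := ENNReal.toReal_mono ENNReal.ofReal_ne_top hbad
  rw [ENNReal.toReal_ofReal (by positivity)] at hbad'
  have hpos : 0 ≤ 2 * d * Real.exp (-(1 * δ ^ 2) / (d * tailSq a n₀)) := by positivity
  rw [measureReal_def] at hone
  linarith
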